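/- Let $Q$ be a smooth $n$-dimensional manifold, $g$ a smooth Riemannian metric on $Q$, and $D\subset TQ$ a smooth distribution of rank $k$ (that is, a smooth vector subbundle of rank $k$), with inclusion $i_D: D\to TQ$. Let $D^{\perp_g}$ be the $g$-orthogonal complement of $D$, let $D^\circ\subset T^*Q$ be the annihilator of $D$, and let $M=(D^{\perp_g})^\circ\subset T^*Q$ be the annihilator of $D^{\perp_g}$, a vector subbundle (hence a submanifold) of $T^*Q$ with inclusion $i_M: M\to T^*Q$. The Whitney sums $TQ=D\oplus D^{\perp_g}$ and $T^*Q=M\oplus D^\circ$ define the orthogonal projections $P:TQ\to D$ and $\gamma:T^*Q\to M$. Let $i_D^*:T^*Q\to D^*$ and $P^*:D^*\to T^*Q$ be the adjoints of $i_D$ and $P$, where $D^*$ is the dual bundle of $D$. Let $\omega_Q=dq^i\wedge dp_i$ be the canonical symplectic form of $T^*Q$, and $\{F,G\}_{can}=\omega_Q(X_F,X_G)$, where $i_{X_F}\omega_Q=dF$, the canonical Poisson bracket. Define $$\{f,h\}_E=\{f\circ\gamma,\,h\circ\gamma\}_{can}\circ i_M\quad (f,h\in C^\infty(M)),\qquad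 \{f,h\}_{D^*}=\{f\circ i_D^*,\,h\circ i_D^*\}_{can}\circ P^*\quad (f,h\in C^\infty(D^*)).$$ Then $\{\cdot,\cdot\}_E$ and $\{\cdot,\cdot\}_{D^*}$ are almost Poisson brackets on $M$ and on $D^*$ respectively, i.e. $\mathbb R$-bilinear skew-symmetric operations on $C^\infty(M)$ and on $C^\infty(D^*)$ that satisfy the Leibniz rule. Moreover, the map $i_{M,D^*}=i_D^*\circ i_M: M\to D^*$ is an isomorphism of smooth vector bundles over the identity of $Q$, and it is an almost Poisson isomorphism from $(M,\{\cdot,\cdot\}_E)$ onto $(D^*,\{\cdot,\cdot\}_{D^*})$, i.e. it is a diffeomorphism and $$\{f\circ i_{M,D^*},\,h\circ i_{M,D^*}\}_E=\{f,h\}_{D^*}\circ i_{M,D^*}\qquad\text{for all } f,h\in C^\infty(D^*).$$ -/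

import Mathlib

open Bundle Manifold Set
open scoped ContDiff Topology

noncomputable section

section Subbundle

variable {EB : Type*} [NormedAddCommGroup EB] [NormedSpace ℝ EB]
  {HB : Type*} [TopologicalSpace HB]
  {B : Type*} [TopologicalSpace B] [ChartedSpace HB B]

/-- A smooth vector subbundle of rank `k` of a vector bundle `V` over `B`: a family of linear
subspaces of the fibres which near every point of `B` is spanned by `k` pointwise linearly
independent smooth local sections of `V`. -/
structure SmoothSubbundle (k : ℕ) (IB : ModelWithCorners ℝ EB HB)
    (F : Type*) [NormedAddCommGroup F] [NormedSpace ℝ F]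
    (V : B → Type*) [TopologicalSpace (TotalSpace F V)] [∀ b, TopologicalSpace (V b)]
    [∀ b, AddCommGroup (V b)] [∀ b, Module ℝ (V b)] [FiberBundle F V] where
  /-- the linear subspace of the fibre at each point -/
  space : ∀ b, Submodule ℝ (V b)
  exists_frame : ∀ b₀, ∃ U : Set B, IsOpen U ∧ b₀ ∈ U ∧ ∃ s : Fin k → ∀ b, V b,
    (∀ i, ContMDiffOn IB (IB.prod 𝓘(ℝ, F)) ∞ (fun b ↦ TotalSpace.mk' F b (s i b)) U) ∧
    ∀ b ∈ U, LinearIndependent ℝ (fun i ↦ s i b) ∧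
      Submodule.span ℝ (range fun i ↦ s i b) = space b

variable {k : ℕ} {IB : ModelWithCorners ℝ EB HB}
  {F : Type*} [NormedAddCommGroup F] [NormedSpace ℝ F]
  {V : B → Type*} [TopologicalSpace (TotalSpace F V)] [∀ b, TopologicalSpace (V b)]
  [∀ b, AddCommGroup (V b)] [∀ b, Module ℝ (V b)] [FiberBundle F V]

namespace SmoothSubbundle

/-- The fibre of the subbundle at `b`, as a vector space of its own. -/
def Fiber (S : SmoothSubbundle k IB F V) (b : B) : Type _ := S.space b

variable (S : SmoothSubbundle k IB F V)

instance (b : B) : AddCommGroup (S.Fiber b) := inferInstanceAs (AddCommGroup (S.space b))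

instance (b : B) : Module ℝ (S.Fiber b) := inferInstanceAs (Module ℝ (S.space b))

instance (b : B) : TopologicalSpace (S.Fiber b) := inferInstanceAs (TopologicalSpace (S.space b))

instance (b : B) [IsTopologicalAddGroup (V b)] : IsTopologicalAddGroup (S.Fiber b) :=
  inferInstanceAs (IsTopologicalAddGroup (S.space b))

instance (b : B) [ContinuousSMul ℝ (V b)] : ContinuousSMul ℝ (S.Fiber b) :=
  inferInstanceAs (ContinuousSMul ℝ (S.space b))

/-- The inclusion of the fibre of the subbundle into the fibre of the ambient bundle. -/
def incl (b : B) : S.Fiber b →L[ℝ] V b := (S.space b).subtypeL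

lemma incl_injective (b : B) : Function.Injective (S.incl b) := Subtype.val_injective

/-- An element of the subspace, as an element of the fibre. -/
def mkFiber {b : B} (v : V b) (hv : v ∈ S.space b) : S.Fiber b := ⟨v, hv⟩

@[simp] lemma incl_mkFiber {b : B} (v : V b) (hv : v ∈ S.space b) :
    S.incl b (S.mkFiber v hv) = v := rfl

lemma incl_mem {b : B} (v : S.Fiber b) : S.incl b v ∈ S.space b := Subtype.prop v

variable [VectorBundle ℝ F V]

/-- Auxiliary data for a local trivialization of the subbundle near `b₀`: on `U`, the map `L` after
the trivialization of the ambient bundle at `b₀` identifies the fibre of the subbundle with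
`ℝ^k`, with inverse given by `A`. -/
structure LocalTriv (b₀ : B) where
  U : Set B
  isOpen_U : IsOpen U
  mem_U : b₀ ∈ U
  U_subset : U ⊆ (trivializationAt F V b₀).baseSet
  L : F →L[ℝ] EuclideanSpace ℝ (Fin k)
  A : B → EuclideanSpace ℝ (Fin k) →L[ℝ] F
  contMDiffOn_A : ContMDiffOn IB 𝓘(ℝ, EuclideanSpace ℝ (Fin k) →L[ℝ] F) ∞ A U
  mem_space : ∀ b ∈ U, ∀ c, (trivializationAt F V b₀).symmL ℝ b (A b c) ∈ S.space b
  L_A : ∀ b ∈ U, ∀ c, L (A b c) = c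
  A_L : ∀ b ∈ U, ∀ v ∈ S.space b,
    A b (L ((trivializationAt F V b₀).continuousLinearMapAt ℝ b v)) =
      (trivializationAt F V b₀).continuousLinearMapAt ℝ b v

lemma nonempty_localTriv [FiniteDimensional ℝ F] [ContMDiffVectorBundle ∞ F V IB] (b₀ : B) :
    Nonempty (S.LocalTriv b₀) := by
  obtain ⟨U, hU, hb₀, s, hs, hspan⟩ := S.exists_frame b₀
  set e := trivializationAt F V b₀ with he
  have hbe : b₀ ∈ e.baseSet := mem_baseSet_trivializationAt F V b₀
  -- the frame in the trivialization
  let T : Fin k → B → F := fun i b ↦ (e ⟨b, s i b⟩).2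
  have hT : ∀ i, ContMDiffOn IB 𝓘(ℝ, F) ∞ (T i) (U ∩ e.baseSet) := fun i ↦
    ((e.contMDiffOn_iff (fun b hb ↦ e.mem_source.2 hb.2)).1 ((hs i).mono inter_subset_left)).2
  let A₀ : B → EuclideanSpace ℝ (Fin k) →L[ℝ] F := fun b ↦
    ∑ i, (EuclideanSpace.proj i : EuclideanSpace ℝ (Fin k) →L[ℝ] ℝ).smulRight (T i b)
  have hA₀_apply : ∀ b c, A₀ b c = ∑ i, c i • T i b := fun b c ↦ by
    simp [A₀]
  have hA₀ : ContMDiffOn IB 𝓘(ℝ, EuclideanSpace ℝ (Fin k) →L[ℝ] F) ∞ A₀ (U ∩ e.baseSet) := by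
    apply contMDiffOn_finsetSum
    intro i _
    exact ((ContinuousLinearMap.smulRightL ℝ (EuclideanSpace ℝ (Fin k)) F
      (EuclideanSpace.proj i)).contMDiff (n := ∞)).comp_contMDiffOn (hT i)
  have hTe : ∀ b ∈ e.baseSet, ∀ c : EuclideanSpace ℝ (Fin k),
      A₀ b c = e.continuousLinearMapAt ℝ b (∑ i, c i • s i b) := fun b hb c ↦ by
    rw [hA₀_apply, map_sum]
    refine Finset.sum_congr rfl fun i _ ↦ ?_
    rw [map_smul, Trivialization.continuousLinearMapAt_apply, e.coe_linearMapAt_of_mem hb]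
  have hinj : Function.Injective (A₀ b₀) := by
    intro c c' h
    rw [hTe _ hbe, hTe _ hbe] at h
    have h2 := congrArg (e.symmL ℝ b₀) h
    rw [e.symmL_continuousLinearMapAt hbe, e.symmL_continuousLinearMapAt hbe] at h2
    have h3 := Fintype.linearIndependent_iff.1 (hspan b₀ hb₀).1 (fun i ↦ c i - c' i)
      (by simp only [sub_smul, Finset.sum_sub_distrib, h2, sub_self])
    ext i
    exact sub_eq_zero.1 (h3 i)
  obtain ⟨L₀, hL₀⟩ := (A₀ b₀).toLinearMap.exists_leftInverse_of_injective
    (LinearMap.ker_eq_bot.2 hinj)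
  let L : F →L[ℝ] EuclideanSpace ℝ (Fin k) := LinearMap.toContinuousLinearMap L₀
  let M : B → EuclideanSpace ℝ (Fin k) →L[ℝ] EuclideanSpace ℝ (Fin k) := fun b ↦ L ∘L A₀ b
  have hM₀ : M b₀ = 1 := by
    ext1 c
    exact LinearMap.congr_fun hL₀ c
  have hM : ContMDiffOn IB 𝓘(ℝ, EuclideanSpace ℝ (Fin k) →L[ℝ] EuclideanSpace ℝ (Fin k)) ∞ M
      (U ∩ e.baseSet) :=
    contMDiffOn_const.clm_comp hA₀
  have hop : IsOpen (U ∩ e.baseSet) := hU.inter e.open_baseSet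
  let W : Set B := (U ∩ e.baseSet) ∩ M ⁻¹' {x | IsUnit x}
  have hW : IsOpen W := hM.continuousOn.isOpen_inter_preimage hop Units.isOpen
  have hMinv : ContMDiffOn IB 𝓘(ℝ, EuclideanSpace ℝ (Fin k) →L[ℝ] EuclideanSpace ℝ (Fin k)) ∞
      (fun b ↦ Ring.inverse (M b)) W := by
    rintro b ⟨hb, ⟨u, hu⟩⟩
    have h1 : ContDiffAt ℝ ∞ Ring.inverse (M b) := hu ▸ contDiffAt_ringInverse ℝ u
    exact (h1.contMDiffAt.comp_contMDiffWithinAt b ((hM b hb).mono inter_subset_left))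
  have hMM : ∀ b ∈ W, ∀ c, M b (Ring.inverse (M b) c) = c := fun b hb c ↦ by
    have := Ring.mul_inverse_cancel _ hb.2
    exact congrArg (fun f : EuclideanSpace ℝ (Fin k) →L[ℝ] EuclideanSpace ℝ (Fin k) ↦ f c) this
  have hMM' : ∀ b ∈ W, ∀ c, Ring.inverse (M b) (M b c) = c := fun b hb c ↦ by
    have := Ring.inverse_mul_cancel _ hb.2
    exact congrArg (fun f : EuclideanSpace ℝ (Fin k) →L[ℝ] EuclideanSpace ℝ (Fin k) ↦ f c) this
  refine ⟨{
    U := W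
    isOpen_U := hW
    mem_U := ⟨⟨hb₀, hbe⟩, by simp [hM₀]⟩
    U_subset := fun b hb ↦ hb.1.2
    L := L
    A := fun b ↦ A₀ b ∘L Ring.inverse (M b)
    contMDiffOn_A := (hA₀.mono inter_subset_left).clm_comp hMinv
    mem_space := ?_
    L_A := fun b hb c ↦ hMM b hb c
    A_L := ?_ }⟩
  · intro b hb c
    rw [ContinuousLinearMap.comp_apply, hTe b hb.1.2, e.symmL_continuousLinearMapAt hb.1.2,
      ← (hspan b hb.1.1).2]
    exact Submodule.sum_mem _ fun i _ ↦ Submodule.smul_mem _ _ (Submodule.subset_span ⟨i, rfl⟩)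
  · intro b hb v hv
    rw [← (hspan b hb.1.1).2, Submodule.mem_span_range_iff_exists_fun] at hv
    obtain ⟨c, rfl⟩ := hv
    have := hTe b hb.1.2 (WithLp.toLp 2 c)
    simp only at this
    rw [← this, ContinuousLinearMap.comp_apply]
    exact congrArg (A₀ b) (hMM' b hb _)

open Classical in
variable {S} in
/-- The inverse of the local trivialization, on the fibre over `b`. -/
def LocalTriv.inv {b₀ : B} (t : S.LocalTriv b₀) (b : B) (c : EuclideanSpace ℝ (Fin k)) :
    S.Fiber b :=
  if h : b ∈ t.U then S.mkFiber _ (t.mem_space b h c) else 0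

variable {S} in
lemma LocalTriv.incl_inv {b₀ : B} (t : S.LocalTriv b₀) {b : B} (hb : b ∈ t.U)
    (c : EuclideanSpace ℝ (Fin k)) :
    S.incl b (t.inv b c) = (trivializationAt F V b₀).symmL ℝ b (t.A b c) := by
  rw [LocalTriv.inv, dif_pos hb, incl_mkFiber]

variable {S} in
lemma LocalTriv.L_inv {b₀ : B} (t : S.LocalTriv b₀) {b : B} (hb : b ∈ t.U)
    (c : EuclideanSpace ℝ (Fin k)) :
    t.L ((trivializationAt F V b₀).continuousLinearMapAt ℝ b (S.incl b (t.inv b c))) = c := by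
  rw [t.incl_inv hb, Trivialization.continuousLinearMapAt_symmL _ (t.U_subset hb), t.L_A b hb]

variable {S} in
lemma LocalTriv.inv_L {b₀ : B} (t : S.LocalTriv b₀) {b : B} (hb : b ∈ t.U) (v : S.Fiber b) :
    t.inv b (t.L ((trivializationAt F V b₀).continuousLinearMapAt ℝ b (S.incl b v))) = v := by
  apply S.incl_injective
  rw [t.incl_inv hb, t.A_L b hb _ (S.incl_mem v),
    Trivialization.symmL_continuousLinearMapAt _ (t.U_subset hb)]

variable {S} in
/-- The local trivialization of the subbundle given by local trivialization data. -/
def LocalTriv.pretriv {b₀ : B} (t : S.LocalTriv b₀) :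
    Pretrivialization (EuclideanSpace ℝ (Fin k)) (π (EuclideanSpace ℝ (Fin k)) S.Fiber) where
  toFun p := (p.1, t.L ((trivializationAt F V b₀).continuousLinearMapAt ℝ p.1 (S.incl p.1 p.2)))
  invFun p := ⟨p.1, t.inv p.1 p.2⟩
  source := TotalSpace.proj ⁻¹' t.U
  target := t.U ×ˢ univ
  map_source' _ h := ⟨h, mem_univ _⟩
  map_target' _ h := h.1
  left_inv' := by
    rintro ⟨b, v⟩ (h : b ∈ t.U)
    exact congrArg (TotalSpace.mk b) (t.inv_L h v)
  right_inv' := by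
    rintro ⟨b, c⟩ ⟨h, -⟩
    exact congrArg (Prod.mk b) (t.L_inv h c)
  open_target := t.isOpen_U.prod isOpen_univ
  baseSet := t.U
  open_baseSet := t.isOpen_U
  source_eq := rfl
  target_eq := rfl
  proj_toFun _ _ := rfl

variable {S} in
lemma LocalTriv.pretriv_symm {b₀ : B} (t : S.LocalTriv b₀) {b : B} (hb : b ∈ t.U)
    (c : EuclideanSpace ℝ (Fin k)) : t.pretriv.symm b c = t.inv b c := by
  rw [Pretrivialization.symm_apply _ (show b ∈ t.pretriv.baseSet from hb)]
  exact cast_eq _ _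

variable [ContMDiffVectorBundle ∞ F V IB]

variable {S} in
lemma LocalTriv.exists_coordChange {b₀ b₁ : B} (t : S.LocalTriv b₀) (t' : S.LocalTriv b₁) :
    ∃ f : B → EuclideanSpace ℝ (Fin k) →L[ℝ] EuclideanSpace ℝ (Fin k),
      ContMDiffOn IB 𝓘(ℝ, EuclideanSpace ℝ (Fin k) →L[ℝ] EuclideanSpace ℝ (Fin k)) ∞ f
        (t.pretriv.baseSet ∩ t'.pretriv.baseSet) ∧
      ∀ b ∈ t.pretriv.baseSet ∩ t'.pretriv.baseSet, ∀ v,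
        f b v = (t'.pretriv ⟨b, t.pretriv.symm b v⟩).2 := by
  refine ⟨fun b ↦ t'.L ∘L ((trivializationAt F V b₀).coordChangeL ℝ (trivializationAt F V b₁) b :
    F →L[ℝ] F) ∘L t.A b, ?_, ?_⟩
  · refine contMDiffOn_const.clm_comp (ContMDiffOn.clm_comp ?_
      (t.contMDiffOn_A.mono inter_subset_left))
    exact (contMDiffOn_coordChangeL (IB := IB) (n := ∞) _ _).mono
      (inter_subset_inter t.U_subset t'.U_subset)
  · rintro b ⟨hb, hb'⟩ v
    rw [t.pretriv_symm hb]
    change _ = t'.L ((trivializationAt F V b₁).continuousLinearMapAt ℝ b (S.incl b (t.inv b v)))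
    rw [t.incl_inv hb, Trivialization.continuousLinearMapAt_apply,
      Trivialization.coe_linearMapAt_of_mem _ (t'.U_subset hb'),
      Trivialization.symmL_apply _ (t.U_subset hb)]
    simp only [ContinuousLinearMap.comp_apply, ContinuousLinearEquiv.coe_coe]
    rw [Trivialization.coordChangeL_apply _ _ ⟨t.U_subset hb, t'.U_subset hb'⟩]

variable [FiniteDimensional ℝ F]

/-- A choice of local trivialization data near each point. -/
def localTriv (b₀ : B) : S.LocalTriv b₀ := (S.nonempty_localTriv b₀).some

/-- The smooth vector bundle structure carried by a smooth subbundle. -/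
def prebundle : VectorPrebundle ℝ (EuclideanSpace ℝ (Fin k)) S.Fiber where
  pretrivializationAtlas := {e | ∃ b₀, e = (S.localTriv b₀).pretriv}
  pretrivialization_linear' := by
    rintro _ ⟨b₀, rfl⟩
    exact ⟨fun b _ ↦ (((S.localTriv b₀).L.comp
      ((trivializationAt F V b₀).continuousLinearMapAt ℝ b)).comp (S.incl b)).toLinearMap.isLinear⟩
  pretrivializationAt b₀ := (S.localTriv b₀).pretriv
  mem_base_pretrivializationAt b₀ := (S.localTriv b₀).mem_U
  pretrivialization_mem_atlas b₀ := ⟨b₀, rfl⟩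
  exists_coordChange := by
    rintro _ ⟨b₀, rfl⟩ _ ⟨b₁, rfl⟩
    obtain ⟨f, hf, hf'⟩ := (S.localTriv b₀).exists_coordChange (S.localTriv b₁)
    exact ⟨f, hf.continuousOn, hf'⟩
  totalSpaceMk_isInducing := by
    intro b
    set t := S.localTriv b
    let φ : S.Fiber b →L[ℝ] EuclideanSpace ℝ (Fin k) :=
      (t.L.comp ((trivializationAt F V b).continuousLinearMapAt ℝ b)).comp (S.incl b)
    have hφ : Topology.IsInducing φ := by
      have hc : Continuous (t.inv b) := by
        apply continuous_induced_rng.2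
        have : (Subtype.val ∘ t.inv b : EuclideanSpace ℝ (Fin k) → V b) =
            fun c ↦ (trivializationAt F V b).symmL ℝ b (t.A b c) :=
          funext fun c ↦ t.incl_inv t.mem_U c
        exact this ▸ ((trivializationAt F V b).symmL ℝ b ∘L t.A b).continuous
      exact (Function.LeftInverse.isEmbedding (f := t.inv b) (g := φ)
        (fun v ↦ t.inv_L t.mem_U v) hc φ.continuous).isInducing
    exact Topology.isInducing_const_prod.mpr hφ

instance : S.prebundle.IsContMDiff IB ∞ where
  exists_contMDiffCoordChange := by
    rintro _ ⟨b₀, rfl⟩ _ ⟨b₁, rfl⟩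
    exact (S.localTriv b₀).exists_coordChange (S.localTriv b₁)

instance : TopologicalSpace (TotalSpace (EuclideanSpace ℝ (Fin k)) S.Fiber) :=
  S.prebundle.totalSpaceTopology

instance : FiberBundle (EuclideanSpace ℝ (Fin k)) S.Fiber := S.prebundle.toFiberBundle

instance : VectorBundle ℝ (EuclideanSpace ℝ (Fin k)) S.Fiber := S.prebundle.toVectorBundle

instance : ContMDiffVectorBundle ∞ (EuclideanSpace ℝ (Fin k)) S.Fiber IB :=
  S.prebundle.contMDiffVectorBundle IB

/-- The inclusion of the total space of the subbundle into that of the ambient bundle. -/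
def inclTotal (p : TotalSpace (EuclideanSpace ℝ (Fin k)) S.Fiber) : TotalSpace F V :=
  ⟨p.1, S.incl p.1 p.2⟩

/-- A map into the total space of the subbundle is smooth if and only if it is smooth as a map
into the ambient bundle. -/
theorem contMDiff_iff_inclTotal {EN : Type*} [NormedAddCommGroup EN] [NormedSpace ℝ EN]
    {HN : Type*} [TopologicalSpace HN] {IN : ModelWithCorners ℝ EN HN} {N : Type*} [TopologicalSpace N]
    [ChartedSpace HN N] (f : N → TotalSpace (EuclideanSpace ℝ (Fin k)) S.Fiber) :
    ContMDiff IN (IB.prod 𝓘(ℝ, EuclideanSpace ℝ (Fin k))) ∞ f ↔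
      ContMDiff IN (IB.prod 𝓘(ℝ, F)) ∞ (fun x ↦ S.inclTotal (f x)) := by
  refine forall_congr' fun x ↦ ?_
  rw [contMDiffAt_totalSpace, contMDiffAt_totalSpace]
  change (ContMDiffAt IN IB ∞ (fun x ↦ (f x).proj) x ∧ _) ↔
    (ContMDiffAt IN IB ∞ (fun x ↦ (f x).proj) x ∧ _)
  refine and_congr_right fun hf ↦ ?_
  set t := S.localTriv (f x).proj with ht
  set e := trivializationAt F V (f x).proj with he
  have hU : ∀ᶠ y in 𝓝 x, (f y).proj ∈ t.U :=
    hf.continuousAt.eventually (t.isOpen_U.mem_nhds t.mem_U)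
  have h1 : ∀ᶠ y in 𝓝 x, (e (S.inclTotal (f y))).2 =
      e.continuousLinearMapAt ℝ (f y).proj (S.incl _ (f y).2) := by
    filter_upwards [hU] with y hy
    rw [Trivialization.continuousLinearMapAt_apply,
      Trivialization.coe_linearMapAt_of_mem _ (t.U_subset hy)]
    rfl
  have h2 : ∀ y, (trivializationAt (EuclideanSpace ℝ (Fin k)) S.Fiber (f x).proj (f y)).2 =
      t.L (e.continuousLinearMapAt ℝ (f y).proj (S.incl _ (f y).2)) := fun y ↦ rfl
  constructor
  · intro h
    have hA : ContMDiffAt IN 𝓘(ℝ, EuclideanSpace ℝ (Fin k) →L[ℝ] F) ∞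
        (fun y ↦ t.A (f y).proj) x :=
      (t.contMDiffOn_A.contMDiffAt (t.isOpen_U.mem_nhds t.mem_U)).comp x hf
    refine (hA.clm_apply h).congr_of_eventuallyEq ?_
    filter_upwards [hU, h1] with y hy hy1
    refine hy1.trans ?_
    rw [h2 y, t.A_L _ hy _ (S.incl_mem _)]
  · intro h
    refine (t.L.contMDiff.contMDiffAt.comp x h).congr_of_eventuallyEq ?_
    filter_upwards [h1] with y hy1
    rw [h2 y]
    exact congrArg t.L hy1.symm

end SmoothSubbundle
end Subbundle

section Cotangent

variable {n : ℕ} {Q : Type*} [TopologicalSpace Q] [ChartedSpace (EuclideanSpace ℝ (Fin n)) Q]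
  [IsManifold (𝓡 n) ∞ Q]

/-- The total space of the cotangent bundle of an `n`-dimensional manifold `Q`. -/
abbrev CotangentBundle (n : ℕ) (Q : Type*) [TopologicalSpace Q]
    [ChartedSpace (EuclideanSpace ℝ (Fin n)) Q] : Type _ :=
  TotalSpace (EuclideanSpace ℝ (Fin n) →L[ℝ] ℝ)
    (fun q : Q ↦ TangentSpace (𝓡 n) q →L[ℝ] ℝ)

/-- The model with corners of the cotangent bundle, with model space `ℝⁿ × (ℝⁿ)*`. -/
abbrev cotangentModel (n : ℕ) := (𝓡 n).prod 𝓘(ℝ, EuclideanSpace ℝ (Fin n) →L[ℝ] ℝ)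

/-- The canonical coordinates `(q, p)` of the cotangent bundle induced by the chart of `Q` at the
base point of `α`: `q` is given by the chart, and `p` is the covector expressed in the coordinate
frame of the tangent bundle. -/
def canonicalCoords (α β : CotangentBundle n Q) :
    EuclideanSpace ℝ (Fin n) × (EuclideanSpace ℝ (Fin n) →L[ℝ] ℝ) :=
  (extChartAt (𝓡 n) α.proj β.proj,
    β.snd ∘L (trivializationAt (EuclideanSpace ℝ (Fin n)) (TangentSpace (𝓡 n)) α.proj).symmL ℝ
      β.proj)

lemma canonicalCoords_eq_extChartAt (α : CotangentBundle n Q) :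
    canonicalCoords α = extChartAt (cotangentModel n) α := by
  funext β
  have h : extChartAt (cotangentModel n) α β =
      chartAt (ModelProd (EuclideanSpace ℝ (Fin n)) (EuclideanSpace ℝ (Fin n) →L[ℝ] ℝ)) α β := rfl
  rw [h, hom_chart]
  refine Prod.ext rfl ?_
  ext v
  simp [canonicalCoords, ContinuousLinearMap.inCoordinates]

/-- The differential at `α` of the canonical coordinates. -/
def dCanonicalCoords (α : CotangentBundle n Q) :
    TangentSpace (cotangentModel n) α →L[ℝ]
      EuclideanSpace ℝ (Fin n) × (EuclideanSpace ℝ (Fin n) →L[ℝ] ℝ) :=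
  mvfderiv (cotangentModel n) (canonicalCoords α) α

/-- The canonical symplectic form `ω_Q = dqⁱ ∧ dpᵢ` at `α`. -/
def canonicalForm (α : CotangentBundle n Q) (Z W : TangentSpace (cotangentModel n) α) : ℝ :=
  (dCanonicalCoords α W).2 (dCanonicalCoords α Z).1 -
    (dCanonicalCoords α Z).2 (dCanonicalCoords α W).1

lemma dCanonicalCoords_bijective (α : CotangentBundle n Q) :
    Function.Bijective (dCanonicalCoords α) := by
  have : IsManifold (cotangentModel n) ∞ (CotangentBundle n Q) := inferInstance
  have : IsManifold (cotangentModel n) 1 (CotangentBundle n Q) := IsManifold.of_le (n := ∞) (by simp)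
  obtain ⟨e, he⟩ := isInvertible_mfderiv_extChartAt (I := cotangentModel n)
    (mem_extChartAt_source (I := cotangentModel n) α)
  have h : ⇑(dCanonicalCoords α) = ⇑e := by
    funext Z
    rw [dCanonicalCoords, canonicalCoords_eq_extChartAt]
    exact congrArg (fun f ↦ f Z) he.symm
  rw [h]
  exact e.bijective

/-- Nondegeneracy of the canonical symplectic form. -/
theorem existsUnique_canonicalForm_eq (α : CotangentBundle n Q)
    (φ : TangentSpace (cotangentModel n) α →L[ℝ] ℝ) :
    ∃! X : TangentSpace (cotangentModel n) α, ∀ Z, canonicalForm α X Z = φ Z := by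
  set κ := dCanonicalCoords α with hκ
  let e : TangentSpace (cotangentModel n) α ≃ₗ[ℝ]
      EuclideanSpace ℝ (Fin n) × (EuclideanSpace ℝ (Fin n) →L[ℝ] ℝ) :=
    LinearEquiv.ofBijective κ.toLinearMap (dCanonicalCoords_bijective α)
  have heκ : ∀ Z, e Z = κ Z := fun _ ↦ rfl
  have hω : ∀ Z W, canonicalForm α Z W = (e W).2 (e Z).1 - (e Z).2 (e W).1 := fun _ _ ↦ rfl
  let ψ : EuclideanSpace ℝ (Fin n) × (EuclideanSpace ℝ (Fin n) →L[ℝ] ℝ) →ₗ[ℝ] ℝ :=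
    φ.toLinearMap ∘ₗ e.symm.toLinearMap
  have hψ : ∀ Z, φ Z = ψ (e Z) := fun Z ↦ by simp [ψ]
  let ψ₁ : EuclideanSpace ℝ (Fin n) →ₗ[ℝ] ℝ := ψ ∘ₗ LinearMap.inl ℝ _ _
  let ψ₂ : (EuclideanSpace ℝ (Fin n) →L[ℝ] ℝ) →ₗ[ℝ] ℝ := ψ ∘ₗ LinearMap.inr ℝ _ _
  have hψ₁₂ : ∀ v b, ψ (v, b) = ψ₁ v + ψ₂ b := fun v b ↦ by
    have h1 : (v, b) = LinearMap.inl ℝ (EuclideanSpace ℝ (Fin n))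
      (EuclideanSpace ℝ (Fin n) →L[ℝ] ℝ) v + LinearMap.inr ℝ _ _ b := by simp
    rw [h1, map_add]
    rfl
  let a : EuclideanSpace ℝ (Fin n) →L[ℝ] ℝ := LinearMap.toContinuousLinearMap (-ψ₁)
  have ha : ∀ v, a v = -ψ₁ v := fun _ ↦ rfl
  let u : EuclideanSpace ℝ (Fin n) := WithLp.toLp 2 fun i ↦ ψ₂ (EuclideanSpace.proj i)
  have hu' : ∀ i, u i = ψ₂ (EuclideanSpace.proj i) := fun _ ↦ rfl
  have hu : ∀ b : EuclideanSpace ℝ (Fin n) →L[ℝ] ℝ, b u = ψ₂ b := by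
    intro b
    have hb : b = ∑ i, b (EuclideanSpace.single i 1) •
        (EuclideanSpace.proj i : EuclideanSpace ℝ (Fin n) →L[ℝ] ℝ) := by
      ext v
      conv_lhs => rw [← (EuclideanSpace.basisFun (Fin n) ℝ).sum_repr v]
      simp [mul_comm]
    conv_rhs => rw [hb, map_sum]
    conv_lhs => rw [hb]
    simp [hu']
  clear_value ψ ψ₁ ψ₂ a u e
  refine ⟨e.symm (u, a), fun Z ↦ ?_, fun Y hY ↦ ?_⟩
  · rw [hω, hψ, LinearEquiv.apply_symm_apply, hu, ha, ← Prod.mk.eta (p := e Z), hψ₁₂]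
    ring
  · rw [LinearEquiv.eq_symm_apply]
    have key : ∀ v b, b (e Y).1 - (e Y).2 v = ψ₁ v + ψ₂ b := fun v b ↦ by
      have := hY (e.symm (v, b))
      rwa [hω, hψ, LinearEquiv.apply_symm_apply, hψ₁₂] at this
    refine Prod.ext ?_ ?_
    · ext i
      have := key 0 (EuclideanSpace.proj i)
      rw [map_zero, map_zero, zero_add, sub_zero] at this
      rw [hu', ← this]
      rfl
    · ext1 v
      have := key v 0
      rw [map_zero, add_zero, zero_apply, zero_sub] at this
      rw [ha, ← this, neg_neg]

/-- The Hamiltonian vector field `X_F` of `F`, determined by `i_{X_F} ω_Q = dF`. -/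
def hamiltonianVectorField (F : CotangentBundle n Q → ℝ) (α : CotangentBundle n Q) :
    TangentSpace (cotangentModel n) α :=
  (existsUnique_canonicalForm_eq α (mvfderiv (cotangentModel n) F α)).choose

lemma canonicalForm_hamiltonianVectorField (F : CotangentBundle n Q → ℝ)
    (α : CotangentBundle n Q) (Z : TangentSpace (cotangentModel n) α) :
    canonicalForm α (hamiltonianVectorField F α) Z = mvfderiv (cotangentModel n) F α Z :=
  (existsUnique_canonicalForm_eq α (mvfderiv (cotangentModel n) F α)).choose_spec.1 Z

/-- The canonical Poisson bracket `{F, G}_can = ω_Q(X_F, X_G)` on the cotangent bundle. -/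
def canonicalBracket (F G : CotangentBundle n Q → ℝ) : CotangentBundle n Q → ℝ :=
  fun α ↦ canonicalForm α (hamiltonianVectorField F α) (hamiltonianVectorField G α)

end Cotangent

section AlmostPoisson

variable {E : Type*} [NormedAddCommGroup E] [NormedSpace ℝ E] {H : Type*} [TopologicalSpace H]
  {X : Type*} [TopologicalSpace X] [ChartedSpace H X]
  {E' : Type*} [NormedAddCommGroup E'] [NormedSpace ℝ E'] {H' : Type*} [TopologicalSpace H']
  {Y : Type*} [TopologicalSpace Y] [ChartedSpace H' Y]

/-- `br` is an almost Poisson bracket on `C^∞(X)`: an `ℝ`-bilinear, skew-symmetric operation on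
smooth functions that satisfies the Leibniz rule. -/
structure IsAlmostPoissonBracket (I : ModelWithCorners ℝ E H)
    (br : (X → ℝ) → (X → ℝ) → X → ℝ) : Prop where
  contMDiff : ∀ f g, ContMDiff I 𝓘(ℝ) ∞ f → ContMDiff I 𝓘(ℝ) ∞ g → ContMDiff I 𝓘(ℝ) ∞ (br f g)
  add_left : ∀ f f' g, ContMDiff I 𝓘(ℝ) ∞ f → ContMDiff I 𝓘(ℝ) ∞ f' → ContMDiff I 𝓘(ℝ) ∞ g →
    br (f + f') g = br f g + br f' g
  smul_left : ∀ (c : ℝ) f g, ContMDiff I 𝓘(ℝ) ∞ f → ContMDiff I 𝓘(ℝ) ∞ g →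
    br (c • f) g = c • br f g
  add_right : ∀ f g g', ContMDiff I 𝓘(ℝ) ∞ f → ContMDiff I 𝓘(ℝ) ∞ g → ContMDiff I 𝓘(ℝ) ∞ g' →
    br f (g + g') = br f g + br f g'
  smul_right : ∀ (c : ℝ) f g, ContMDiff I 𝓘(ℝ) ∞ f → ContMDiff I 𝓘(ℝ) ∞ g →
    br f (c • g) = c • br f g
  skew : ∀ f g, ContMDiff I 𝓘(ℝ) ∞ f → ContMDiff I 𝓘(ℝ) ∞ g → br g f = -br f g
  leibniz : ∀ f f' g, ContMDiff I 𝓘(ℝ) ∞ f → ContMDiff I 𝓘(ℝ) ∞ f' → ContMDiff I 𝓘(ℝ) ∞ g →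
    br (f * f') g = f * br f' g + f' * br f g

/-- `Φ` is an almost Poisson isomorphism: a diffeomorphism such that
`{f ∘ Φ, g ∘ Φ}_X = {f, g}_Y ∘ Φ` for all smooth functions `f`, `g` on `Y`. -/
structure IsAlmostPoissonIso (I : ModelWithCorners ℝ E H) (J : ModelWithCorners ℝ E' H')
    (brX : (X → ℝ) → (X → ℝ) → X → ℝ) (brY : (Y → ℝ) → (Y → ℝ) → Y → ℝ) (Φ : X → Y) : Prop where
  isAlmostPoissonBracket_source : IsAlmostPoissonBracket I brX
  isAlmostPoissonBracket_target : IsAlmostPoissonBracket J brY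
  isDiffeomorph : ∃ e : X ≃ₘ⟮I, J⟯ Y, ⇑e = Φ
  bracket_comp : ∀ f g, ContMDiff J 𝓘(ℝ) ∞ f → ContMDiff J 𝓘(ℝ) ∞ g →
    brX (f ∘ Φ) (g ∘ Φ) = brY f g ∘ Φ

/-- `Φ` is an isomorphism of smooth vector bundles over the identity of `B`: a diffeomorphism of
the total spaces that restricts to a linear isomorphism from each fibre onto the fibre over the
same point. -/
structure IsVectorBundleIso {B : Type*} [TopologicalSpace B] [ChartedSpace H B]
    (I : ModelWithCorners ℝ E H)
    {F₁ : Type*} [NormedAddCommGroup F₁] [NormedSpace ℝ F₁]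
    {V₁ : B → Type*} [TopologicalSpace (TotalSpace F₁ V₁)] [∀ b, TopologicalSpace (V₁ b)]
    [∀ b, AddCommGroup (V₁ b)] [∀ b, Module ℝ (V₁ b)] [FiberBundle F₁ V₁]
    {F₂ : Type*} [NormedAddCommGroup F₂] [NormedSpace ℝ F₂]
    {V₂ : B → Type*} [TopologicalSpace (TotalSpace F₂ V₂)] [∀ b, TopologicalSpace (V₂ b)]
    [∀ b, AddCommGroup (V₂ b)] [∀ b, Module ℝ (V₂ b)] [FiberBundle F₂ V₂]
    (Φ : TotalSpace F₁ V₁ → TotalSpace F₂ V₂) : Prop where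
  isDiffeomorph : ∃ e : TotalSpace F₁ V₁ ≃ₘ⟮I.prod 𝓘(ℝ, F₁), I.prod 𝓘(ℝ, F₂)⟯ TotalSpace F₂ V₂,
    ⇑e = Φ
  linear_fibers : ∃ φ : ∀ b, V₁ b ≃ₗ[ℝ] V₂ b, ∀ b v, Φ ⟨b, v⟩ = ⟨b, φ b v⟩

end AlmostPoisson

section Nonholonomic

variable {n k : ℕ} {Q : Type*} [TopologicalSpace Q] [ChartedSpace (EuclideanSpace ℝ (Fin n)) Q]
  [IsManifold (𝓡 n) ∞ Q]

/-- A smooth Riemannian metric on the `n`-dimensional manifold `Q`. -/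
abbrev RiemannianMetricOn (n : ℕ) (Q : Type*) [TopologicalSpace Q]
    [ChartedSpace (EuclideanSpace ℝ (Fin n)) Q] [IsManifold (𝓡 n) ∞ Q] : Type _ :=
  ContMDiffRiemannianMetric (𝓡 n) ∞ (EuclideanSpace ℝ (Fin n))
    (TangentSpace (𝓡 n) : Q → Type _)

/-- A smooth distribution of rank `k` on the `n`-dimensional manifold `Q`, that is, a smooth
subbundle of rank `k` of its tangent bundle. -/
abbrev SmoothDistribution (k n : ℕ) (Q : Type*) [TopologicalSpace Q]
    [ChartedSpace (EuclideanSpace ℝ (Fin n)) Q] [IsManifold (𝓡 n) ∞ Q] : Type _ :=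
  SmoothSubbundle k (𝓡 n) (EuclideanSpace ℝ (Fin n)) (TangentSpace (𝓡 n) : Q → Type _)

instance (q : Q) : FiniteDimensional ℝ (TangentSpace (𝓡 n) q) :=
  inferInstanceAs (FiniteDimensional ℝ (EuclideanSpace ℝ (Fin n)))

instance (q : Q) : T2Space (TangentSpace (𝓡 n) q) :=
  inferInstanceAs (T2Space (EuclideanSpace ℝ (Fin n)))

variable (g : RiemannianMetricOn n Q) (D : SmoothDistribution k n Q)

/-- The orthogonal complement `D^⊥` of `D` with respect to `g`. -/
def orthogonalComplement (q : Q) : Submodule ℝ (TangentSpace (𝓡 n) q) where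
  carrier := {v | ∀ w ∈ D.space q, g.inner q v w = 0}
  add_mem' hv hv' w hw := by simp [hv w hw, hv' w hw]
  zero_mem' w _ := by simp
  smul_mem' c v hv w hw := by simp [hv w hw]

/-- The annihilator `D°` of `D`. -/
def annihilator (q : Q) : Submodule ℝ (TangentSpace (𝓡 n) q →L[ℝ] ℝ) where
  carrier := {α | ∀ v ∈ D.space q, α v = 0}
  add_mem' hα hα' v hv := by simp [hα v hv, hα' v hv]
  zero_mem' v _ := by simp
  smul_mem' c α hα v hv := by simp [hα v hv]

/-- The annihilator `(D^⊥)°` of `D^⊥`. -/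
def constraintSpace (q : Q) : Submodule ℝ (TangentSpace (𝓡 n) q →L[ℝ] ℝ) where
  carrier := {α | ∀ v ∈ orthogonalComplement g D q, α v = 0}
  add_mem' hα hα' v hv := by simp [hα v hv, hα' v hv]
  zero_mem' v _ := by simp
  smul_mem' c α hα v hv := by simp [hα v hv]

/-- The Whitney sum `TQ = D ⊕ D^⊥`. -/
theorem isCompl_orthogonalComplement (q : Q) :
    IsCompl (D.space q) (orthogonalComplement g D q) := by
  let b : LinearMap.BilinForm ℝ (TangentSpace (𝓡 n) q) :=
    LinearMap.mk₂ ℝ (fun v w ↦ g.inner q v w) (by simp) (by simp) (by simp) (by simp)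
  have hb : ∀ v w, b v w = g.inner q v w := fun _ _ ↦ rfl
  have hsymm : b.IsRefl := fun v w h ↦ by
    rw [hb] at h ⊢
    rw [g.symm, h]
  have ho : b.orthogonal (D.space q) = orthogonalComplement g D q := by
    ext v
    refine forall₂_congr fun w _ ↦ ?_
    change b w v = 0 ↔ _
    rw [hb, g.symm]
  rw [← ho, LinearMap.BilinForm.isCompl_orthogonal_iff_disjoint hsymm, ho, Submodule.disjoint_def]
  intro v hv hv'
  by_contra h
  exact (g.pos q v h).ne' (hv' v hv)

lemma flat_bijective (q : Q) : Function.Bijective (g.inner q) := by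
  have hinj : Function.Injective (g.inner q) := by
    refine (injective_iff_map_eq_zero (g.inner q)).2 fun v hv ↦ ?_
    by_contra h
    exact (g.pos q v h).ne' (by rw [hv]; rfl)
  refine ⟨hinj, ?_⟩
  have hd : Module.finrank ℝ (TangentSpace (𝓡 n) q) =
      Module.finrank ℝ (TangentSpace (𝓡 n) q →L[ℝ] ℝ) := by
    rw [← (LinearMap.toContinuousLinearMap (𝕜 := ℝ) (E := TangentSpace (𝓡 n) q)
      (F' := ℝ)).finrank_eq]
    exact (Subspace.dual_finrank_eq (K := ℝ) (V := TangentSpace (𝓡 n) q)).symm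
  exact (LinearMap.injective_iff_surjective_of_finrank_eq_finrank
    (f := (g.inner q).toLinearMap) hd).1 hinj

/-- `M = (D^⊥)°` is the image of `D` under `v ↦ g(v, ·)`. -/
lemma constraintSpace_eq_map (q : Q) :
    constraintSpace g D q = (D.space q).map (g.inner q).toLinearMap := by
  ext α
  rw [Submodule.mem_map]
  constructor
  · intro hα
    obtain ⟨v, rfl⟩ := (flat_bijective g q).2 α
    obtain ⟨w, hw, u, hu, rfl⟩ :=
      Submodule.mem_sup.1 ((isCompl_orthogonalComplement g D q).sup_eq_top ▸
        Submodule.mem_top (x := v))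
    have h0 : u = 0 := by
      by_contra h
      have h1 := hα u hu
      rw [map_add] at h1
      have h2 : g.inner q w u = 0 := by rw [g.symm]; exact hu w hw
      change g.inner q w u + g.inner q u u = 0 at h1
      rw [h2, zero_add] at h1
      exact (g.pos q u h).ne' h1
    exact ⟨w, hw, by simp [h0]⟩
  · rintro ⟨v, hv, rfl⟩ u hu
    change g.inner q v u = 0
    rw [g.symm]
    exact hu v hv

/-- The Whitney sum `T*Q = M ⊕ D°`. -/
theorem isCompl_constraintSpace (q : Q) :
    IsCompl (constraintSpace g D q) (annihilator D q) := by
  have h := isCompl_orthogonalComplement g D q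
  have ha : annihilator D q = (orthogonalComplement g D q).map (g.inner q).toLinearMap := by
    ext α
    rw [Submodule.mem_map]
    constructor
    · intro hα
      obtain ⟨v, rfl⟩ := (flat_bijective g q).2 α
      exact ⟨v, hα, rfl⟩
    · rintro ⟨v, hv, rfl⟩ u hu
      exact hv u hu
  rw [constraintSpace_eq_map, ha]
  constructor
  · exact Submodule.disjoint_map (flat_bijective g q).1 h.disjoint
  · rw [codisjoint_iff, ← Submodule.map_sup, h.sup_eq_top, Submodule.map_top,
      LinearMap.range_eq_top]
    exact (flat_bijective g q).2

/-- The constraint submanifold `M = (D^⊥)°`, as a smooth subbundle of the cotangent bundle. -/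
def constraintBundle : SmoothSubbundle k (𝓡 n) (EuclideanSpace ℝ (Fin n) →L[ℝ] ℝ)
    (fun q : Q ↦ TangentSpace (𝓡 n) q →L[ℝ] ℝ) where
  space := constraintSpace g D
  exists_frame q₀ := by
    obtain ⟨U, hU, hq, s, hs, hspan⟩ := D.exists_frame q₀
    refine ⟨U, hU, hq, fun i q ↦ g.inner q (s i q), fun i ↦ ?_, fun q hq ↦ ⟨?_, ?_⟩⟩
    · exact ContMDiffOn.clm_bundle_apply (b := id) (g.contMDiff.contMDiffOn) (hs i)
    · exact (hspan q hq).1.map' (g.inner q).toLinearMap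
        (LinearMap.ker_eq_bot.2 (flat_bijective g q).1)
    · rw [constraintSpace_eq_map, ← (hspan q hq).2, Submodule.map_span, ← range_comp]
      rfl

/-- The constraint submanifold `M`, a submanifold of the cotangent bundle: its smooth structure is
characterized by `SmoothSubbundle.contMDiff_iff_inclTotal`. -/
abbrev ConstraintManifold : Type _ :=
  TotalSpace (EuclideanSpace ℝ (Fin k)) (constraintBundle g D).Fiber

/-- The dual bundle `D*`. -/
abbrev DualBundle : Type _ :=
  TotalSpace (EuclideanSpace ℝ (Fin k) →L[ℝ] ℝ) (fun q : Q ↦ D.Fiber q →L[ℝ] ℝ)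

/-- The inclusion `i_M : M → T*Q`. -/
def iM : ConstraintManifold g D → CotangentBundle n Q := (constraintBundle g D).inclTotal

/-- The projection `γ : T*Q → M` of the Whitney sum `T*Q = M ⊕ D°`. As `M` and `D°` are the images of
`D` and `D^⊥` under `v ↦ g(v, ·)`, it is orthogonal for the metric induced on covectors. -/
def gammaProj (α : CotangentBundle n Q) : ConstraintManifold g D :=
  ⟨α.proj, (constraintSpace g D α.proj).projectionOnto (annihilator D α.proj)
    (isCompl_constraintSpace g D α.proj) α.snd⟩

/-- The orthogonal projection `P : TQ → D` of the decomposition `TQ = D ⊕ D^⊥`, at `q`. -/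
def projD (q : Q) : TangentSpace (𝓡 n) q →L[ℝ] D.Fiber q :=
  LinearMap.toContinuousLinearMap ((D.space q).projectionOnto (orthogonalComplement g D q)
    (isCompl_orthogonalComplement g D q) : TangentSpace (𝓡 n) q →ₗ[ℝ] D.Fiber q)

/-- The adjoint `i_D^* : T*Q → D*` of the inclusion of `D`. -/
def iDStar (α : CotangentBundle n Q) : DualBundle D := ⟨α.proj, α.snd ∘L D.incl α.proj⟩

/-- The adjoint `P^* : D* → T*Q` of the projection `P`. -/
def pStar (μ : DualBundle D) : CotangentBundle n Q := ⟨μ.proj, μ.snd ∘L projD g D μ.proj⟩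

/-- The Eden bracket `{f, h}_E = {f ∘ γ, h ∘ γ}_can ∘ i_M` on `M`. -/
def edenBracket (f h : ConstraintManifold g D → ℝ) : ConstraintManifold g D → ℝ :=
  canonicalBracket (f ∘ gammaProj g D) (h ∘ gammaProj g D) ∘ iM g D

/-- The bracket `{f, h}_{D*} = {f ∘ i_D^*, h ∘ i_D^*}_can ∘ P^*` on `D*`. -/
def dualBracket (f h : DualBundle D → ℝ) : DualBundle D → ℝ :=
  canonicalBracket (f ∘ iDStar D) (h ∘ iDStar D) ∘ pStar g D

end Nonholonomic

end

/-! The argument rests on three identities between the structure maps: `i_D^* ∘ P^* = id` (dual to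
`P ∘ i_D = id`), `γ ∘ i_M = id`, and `i_M ∘ γ = P^* ∘ i_D^*` (`iM_comp_gammaProj`). The last holds
because `α ∘ i_D ∘ P` kills `D^⊥` and differs from `α` by a covector killing `D`, so it is the
`M`-component of `α`.

Put `Φ = i_D^* ∘ i_M`. The identities make `γ ∘ P^*` its inverse and give `Φ ∘ γ = i_D^*` and `P^* ∘
Φ = i_M`. Hence `{f ∘ Φ, h ∘ Φ}_E` and `{f, h}_{D*} ∘ Φ` are the same canonical bracket of `f ∘
i_D^*` and `h ∘ i_D^*`, evaluated along the same map. Both brackets have the form `{f ∘ r, h ∘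
r}_can ∘ s` with `r ∘ s = id`, and this passes on all the required rules
(`IsAlmostPoissonBracket.of_retraction`).

The remaining work is smoothness. For `P` it follows from the formula `(Aᵀ G A)⁻¹ Aᵀ G` in a local
frame (`contMDiffAt_inverse_gram`); then `P^*` and `γ` follow. For the canonical bracket, the
difficulty is that `canonicalForm` at `α` uses the chart centred at `α`, so the chart varies with
the point. Cotangent lifts are symplectic, so one fixed chart gives the same form
(`canonicalForm_eq_standardForm`), and there the bracket is a polynomial in partial derivatives. -/

noncomputable section

/-! ### Composition in Hom bundles -/

section HomBundle

variable {𝕜 B F₁ F₂ F₃ M : Type*} [NontriviallyNormedField 𝕜] {n : WithTop ℕ∞}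
  {E₁ : B → Type*} [∀ x, AddCommGroup (E₁ x)] [∀ x, Module 𝕜 (E₁ x)]
  [NormedAddCommGroup F₁] [NormedSpace 𝕜 F₁]
  [TopologicalSpace (TotalSpace F₁ E₁)] [∀ x, TopologicalSpace (E₁ x)]
  {E₂ : B → Type*} [∀ x, AddCommGroup (E₂ x)] [∀ x, Module 𝕜 (E₂ x)]
  [NormedAddCommGroup F₂] [NormedSpace 𝕜 F₂]
  [TopologicalSpace (TotalSpace F₂ E₂)] [∀ x, TopologicalSpace (E₂ x)]
  {E₃ : B → Type*} [∀ x, AddCommGroup (E₃ x)] [∀ x, Module 𝕜 (E₃ x)]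
  [NormedAddCommGroup F₃] [NormedSpace 𝕜 F₃]
  [TopologicalSpace (TotalSpace F₃ E₃)] [∀ x, TopologicalSpace (E₃ x)]
  {EB : Type*} [NormedAddCommGroup EB] [NormedSpace 𝕜 EB] {HB : Type*} [TopologicalSpace HB]
  {IB : ModelWithCorners 𝕜 EB HB} [TopologicalSpace B] [ChartedSpace HB B] {EM : Type*}
  [NormedAddCommGroup EM] [NormedSpace 𝕜 EM] {HM : Type*} [TopologicalSpace HM]
  {IM : ModelWithCorners 𝕜 EM HM} [TopologicalSpace M] [ChartedSpace HM M]
  [FiberBundle F₁ E₁] [VectorBundle 𝕜 F₁ E₁]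
  [FiberBundle F₂ E₂] [VectorBundle 𝕜 F₂ E₂]
  [FiberBundle F₃ E₃] [VectorBundle 𝕜 F₃ E₃]
  [∀ x, IsTopologicalAddGroup (E₂ x)] [∀ x, ContinuousSMul 𝕜 (E₂ x)]
  [∀ x, IsTopologicalAddGroup (E₃ x)] [∀ x, ContinuousSMul 𝕜 (E₃ x)]

/-- The fibrewise composition of two `C^n` families of linear maps between the fibres of vector
bundles is `C^n`. -/
lemma ContMDiffAt.clm_bundle_comp {b : M → B} {x : M}
    {ψ : ∀ m, E₂ (b m) →L[𝕜] E₃ (b m)} {ϕ : ∀ m, E₁ (b m) →L[𝕜] E₂ (b m)}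
    (hψ : ContMDiffAt IM (IB.prod 𝓘(𝕜, F₂ →L[𝕜] F₃)) n
      (fun m ↦ TotalSpace.mk' (F₂ →L[𝕜] F₃) (E := fun (y : B) ↦ (E₂ y →L[𝕜] E₃ y)) (b m) (ψ m)) x)
    (hϕ : ContMDiffAt IM (IB.prod 𝓘(𝕜, F₁ →L[𝕜] F₂)) n
      (fun m ↦ TotalSpace.mk' (F₁ →L[𝕜] F₂) (E := fun (y : B) ↦ (E₁ y →L[𝕜] E₂ y)) (b m) (ϕ m)) x) :
    ContMDiffAt IM (IB.prod 𝓘(𝕜, F₁ →L[𝕜] F₃)) n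
      (fun m ↦ TotalSpace.mk' (F₁ →L[𝕜] F₃) (E := fun (y : B) ↦ (E₁ y →L[𝕜] E₃ y)) (b m)
        (ψ m ∘L ϕ m)) x := by
  rw [contMDiffAt_hom_bundle] at hψ hϕ ⊢
  refine ⟨hψ.1, (hψ.2.clm_comp hϕ.2).congr_of_eventuallyEq ?_⟩
  -- The coordinate expressions multiply only where the trivialization of the middle bundle is
  -- invertible, so that it cancels.
  have A : ∀ᶠ m in 𝓝 x, b m ∈ (trivializationAt F₂ E₂ (b x)).baseSet :=
    hψ.1.continuousAt ((trivializationAt F₂ E₂ (b x)).open_baseSet.mem_nhds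
      (FiberBundle.mem_baseSet_trivializationAt' (b x)))
  filter_upwards [A] with m hm
  ext1 v
  simp only [ContinuousLinearMap.inCoordinates, ContinuousLinearMap.comp_apply]
  rw [Trivialization.symmL_continuousLinearMapAt _ hm]

end HomBundle

/-! ### Smoothness of the inclusion of a subbundle -/

section Subbundle

variable {EB : Type*} [NormedAddCommGroup EB] [NormedSpace ℝ EB]
  {HB : Type*} [TopologicalSpace HB]
  {B : Type*} [TopologicalSpace B] [ChartedSpace HB B]
  {k : ℕ} {IB : ModelWithCorners ℝ EB HB}
  {F : Type*} [NormedAddCommGroup F] [NormedSpace ℝ F]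
  {V : B → Type*} [TopologicalSpace (TotalSpace F V)] [∀ b, TopologicalSpace (V b)]
  [∀ b, AddCommGroup (V b)] [∀ b, Module ℝ (V b)] [FiberBundle F V]
  [VectorBundle ℝ F V] [ContMDiffVectorBundle ∞ F V IB] [FiniteDimensional ℝ F]

namespace SmoothSubbundle

variable (S : SmoothSubbundle k IB F V)

lemma trivializationAt_symmL {b₀ b : B} (hb : b ∈ (S.localTriv b₀).U)
    (c : EuclideanSpace ℝ (Fin k)) :
    (trivializationAt (EuclideanSpace ℝ (Fin k)) S.Fiber b₀).symmL ℝ b c =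
      (S.localTriv b₀).inv b c := by
  have hb' : b ∈ (trivializationAt (EuclideanSpace ℝ (Fin k)) S.Fiber b₀).baseSet := hb
  rw [Trivialization.symmL_apply _ hb']
  exact (S.localTriv b₀).pretriv_symm hb c

lemma trivializationAt_continuousLinearMapAt {b₀ b : B} (hb : b ∈ (S.localTriv b₀).U)
    (v : S.Fiber b) :
    (trivializationAt (EuclideanSpace ℝ (Fin k)) S.Fiber b₀).continuousLinearMapAt ℝ b v =
      (S.localTriv b₀).L ((trivializationAt F V b₀).continuousLinearMapAt ℝ b (S.incl b v)) := by
  have hb' : b ∈ (trivializationAt (EuclideanSpace ℝ (Fin k)) S.Fiber b₀).baseSet := hb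
  rw [Trivialization.continuousLinearMapAt_apply, Trivialization.coe_linearMapAt_of_mem _ hb']
  rfl

/-- The inclusion of the total space of a smooth subbundle is smooth. -/
theorem contMDiff_inclTotal :
    ContMDiff (IB.prod 𝓘(ℝ, EuclideanSpace ℝ (Fin k))) (IB.prod 𝓘(ℝ, F)) ∞ S.inclTotal :=
  (S.contMDiff_iff_inclTotal _).1 contMDiff_id

/-- The trivializations of `S` were built from the frame `A`, so `A` itself represents the
inclusion, and its smoothness is part of the data. -/
lemma inCoordinates_incl {b₀ b : B} (hb : b ∈ (S.localTriv b₀).U) :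
    ContinuousLinearMap.inCoordinates (EuclideanSpace ℝ (Fin k)) S.Fiber F V b₀ b b₀ b (S.incl b) =
      (S.localTriv b₀).A b := by
  ext1 c
  simp only [ContinuousLinearMap.inCoordinates, ContinuousLinearMap.comp_apply]
  rw [S.trivializationAt_symmL hb, LocalTriv.incl_inv _ hb,
    Trivialization.continuousLinearMapAt_symmL _ ((S.localTriv b₀).U_subset hb)]

variable [∀ b, IsTopologicalAddGroup (V b)] [∀ b, ContinuousSMul ℝ (V b)]

/-- The inclusion of a smooth subbundle is a smooth family of linear maps. -/
theorem contMDiff_incl :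
    ContMDiff IB (IB.prod 𝓘(ℝ, EuclideanSpace ℝ (Fin k) →L[ℝ] F)) ∞
      (fun b ↦ TotalSpace.mk' (EuclideanSpace ℝ (Fin k) →L[ℝ] F)
        (E := fun b ↦ (S.Fiber b →L[ℝ] V b)) b (S.incl b)) := by
  intro b₀
  rw [contMDiffAt_hom_bundle]
  refine ⟨contMDiffAt_id, ?_⟩
  have hU := (S.localTriv b₀).isOpen_U.mem_nhds (S.localTriv b₀).mem_U
  refine ((S.localTriv b₀).contMDiffOn_A.contMDiffAt hU).congr_of_eventuallyEq ?_
  filter_upwards [hU] with b hb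
  exact S.inCoordinates_incl hb

end SmoothSubbundle

end Subbundle

/-- The coordinate expression `(Aᵀ G A)⁻¹ Aᵀ G` of an orthogonal projection depends smoothly on the
frame `A` and on the metric `G`. -/
lemma contMDiffAt_inverse_gram {EB : Type*} [NormedAddCommGroup EB] [NormedSpace ℝ EB]
    {HB : Type*} [TopologicalSpace HB] {IB : ModelWithCorners ℝ EB HB}
    {B : Type*} [TopologicalSpace B] [ChartedSpace HB B]
    {F : Type*} [NormedAddCommGroup F] [NormedSpace ℝ F]
    {F' : Type*} [NormedAddCommGroup F'] [NormedSpace ℝ F'] [FiniteDimensional ℝ F']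
    {A : B → F' →L[ℝ] F} {G : B → F →L[ℝ] F →L[ℝ] ℝ} {P : B → F →L[ℝ] F'} {b₀ : B} {U : Set B}
    (hU : U ∈ 𝓝 b₀) (hA : ContMDiffAt IB 𝓘(ℝ, F' →L[ℝ] F) ∞ A b₀)
    (hG : ContMDiffAt IB 𝓘(ℝ, F →L[ℝ] F →L[ℝ] ℝ) ∞ G b₀)
    (hpos : ∀ b ∈ U, ∀ c, c ≠ 0 → G b (A b c) (A b c) ≠ 0)
    (hP : ∀ b ∈ U, ∀ v c, G b (A b (P b v)) (A b c) = G b v (A b c)) :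
    ContMDiffAt IB 𝓘(ℝ, F →L[ℝ] F') ∞ P b₀ := by
  have : CompleteSpace F' := FiniteDimensional.complete ℝ F'
  -- In matrix terms `R = Aᵀ G` and `K = Aᵀ G A` is the Gram matrix of the frame. Hypothesis `hP`
  -- says `K P = R`, hence `P = K⁻¹ R`.
  let R : B → F →L[ℝ] F' →L[ℝ] ℝ := fun b ↦ (ContinuousLinearMap.precomp ℝ (A b)) ∘L G b
  have hR : ContMDiffAt IB 𝓘(ℝ, F →L[ℝ] F' →L[ℝ] ℝ) ∞ R b₀ := by
    have hA' : ContMDiffAt IB 𝓘(ℝ, (F →L[ℝ] ℝ) →L[ℝ] F' →L[ℝ] ℝ) ∞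
      (fun b ↦ ContinuousLinearMap.precomp ℝ (A b)) b₀ := hA.clm_precomp
    exact hA'.clm_comp hG
  let K : B → F' →L[ℝ] F' →L[ℝ] ℝ := fun b ↦ R b ∘L A b
  have hK : ContMDiffAt IB 𝓘(ℝ, F' →L[ℝ] F' →L[ℝ] ℝ) ∞ K b₀ := hR.clm_comp hA
  have hKapp : ∀ b c d, K b c d = G b (A b c) (A b d) := fun _ _ _ ↦ rfl
  have hRapp : ∀ b v d, R b v d = G b v (A b d) := fun _ _ _ ↦ rfl
  have hKinvertible : ∀ b ∈ U, (K b).IsInvertible := by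
    intro b hb
    -- If `K c = 0` then in particular `K c c = 0`, which `hpos` excludes for `c ≠ 0`. Equality of
    -- dimensions then gives invertibility.
    have hinj : Function.Injective (K b) := by
      refine (injective_iff_map_eq_zero (K b)).2 fun c hc ↦ ?_
      by_contra h
      refine hpos b hb c h ?_
      rw [← hKapp, hc]
      rfl
    have hd : Module.finrank ℝ F' = Module.finrank ℝ (F' →L[ℝ] ℝ) := by
      rw [← (LinearMap.toContinuousLinearMap (𝕜 := ℝ) (E := F') (F' := ℝ)).finrank_eq]
      exact (Subspace.dual_finrank_eq (K := ℝ) (V := F')).symm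
    exact ⟨(LinearEquiv.ofInjectiveOfFinrankEq (K b).toLinearMap hinj hd).toContinuousLinearEquiv,
      by ext1 c; rfl⟩
  have hinv : ContDiffAt ℝ ∞
      (ContinuousLinearMap.inverse : (F' →L[ℝ] F' →L[ℝ] ℝ) → (F' →L[ℝ] ℝ) →L[ℝ] F') (K b₀) :=
    (hKinvertible b₀ (mem_of_mem_nhds hU)).contDiffAt_map_inverse
  have hKinv : ContMDiffAt IB 𝓘(ℝ, (F' →L[ℝ] ℝ) →L[ℝ] F') ∞ (fun b ↦ (K b).inverse) b₀ :=
    hinv.contMDiffAt.comp b₀ hK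
  refine (hKinv.clm_comp hR).congr_of_eventuallyEq ?_
  filter_upwards [hU] with b hb
  ext1 v
  obtain ⟨κ, hκ⟩ := hKinvertible b hb
  rw [ContinuousLinearMap.comp_apply, ← hκ, ContinuousLinearMap.inverse_equiv]
  refine κ.eq_symm_apply.2 ?_
  change (κ : F' →L[ℝ] F' →L[ℝ] ℝ) _ = _
  rw [hκ]
  ext1 c
  rw [hKapp, hRapp, hP b hb]

/-! ### The projections `P` and `γ` and their smoothness -/

section Nonholonomic

variable {n k : ℕ} {Q : Type*} [TopologicalSpace Q] [ChartedSpace (EuclideanSpace ℝ (Fin n)) Q]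
  [IsManifold (𝓡 n) ∞ Q] (g : RiemannianMetricOn n Q) (D : SmoothDistribution k n Q)

lemma projD_incl (q : Q) (v : D.Fiber q) : projD g D q (D.incl q v) = v :=
  Submodule.projectionOnto_apply_left (isCompl_orthogonalComplement g D q) v

lemma sub_incl_projD_mem (q : Q) (v : TangentSpace (𝓡 n) q) :
    v - D.incl q (projD g D q v) ∈ orthogonalComplement g D q := by
  refine (Submodule.projectionOnto_apply_eq_zero_iff (isCompl_orthogonalComplement g D q)).1 ?_
  change projD g D q _ = 0
  rw [map_sub, projD_incl, sub_self]

/-- The residual `v - P v` is orthogonal to `D`. These are the normal equations, which serve as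
hypothesis `hP` of `contMDiffAt_inverse_gram`. -/
lemma inner_projD (q : Q) (v : TangentSpace (𝓡 n) q) (w : D.Fiber q) :
    g.inner q (D.incl q (projD g D q v)) (D.incl q w) = g.inner q v (D.incl q w) := by
  have h := sub_incl_projD_mem g D q v _ (D.incl_mem w)
  rw [map_sub, sub_apply, sub_eq_zero] at h
  exact h.symm

lemma iDStar_comp_pStar (μ : DualBundle D) : iDStar D (pStar g D μ) = μ := by
  rcases μ with ⟨q, μ⟩
  refine congrArg (TotalSpace.mk q) ?_
  ext1 v
  exact congrArg μ (projD_incl g D q v)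

lemma gammaProj_comp_iM (α : ConstraintManifold g D) : gammaProj g D (iM g D α) = α := by
  rcases α with ⟨q, α⟩
  exact congrArg (TotalSpace.mk q)
    (Submodule.projectionOnto_apply_left (isCompl_constraintSpace g D q) α)

/-- The projection of `T*Q` onto `M` along `D°` is the adjoint of the projection of `TQ` onto `D`
along `D^⊥`. -/
lemma iM_comp_gammaProj (α : CotangentBundle n Q) :
    iM g D (gammaProj g D α) = pStar g D (iDStar D α) := by
  rcases α with ⟨q, α⟩
  refine congrArg (TotalSpace.mk q) ?_
  set β : TangentSpace (𝓡 n) q →L[ℝ] ℝ := (α ∘L D.incl q) ∘L projD g D q with hβ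
  have h1 : β ∈ constraintSpace g D q := fun v hv ↦ by
    have : projD g D q v = 0 :=
      (Submodule.projectionOnto_apply_eq_zero_iff (isCompl_orthogonalComplement g D q)).2 hv
    simp [hβ, this]
  have h2 : α - β ∈ annihilator D q := fun v hv ↦ by
    have := projD_incl g D q (D.mkFiber v hv)
    rw [SmoothSubbundle.incl_mkFiber] at this
    simp [hβ, this]
  have h3 : (constraintSpace g D q).projectionOnto (annihilator D q)
      (isCompl_constraintSpace g D q) α = ⟨β, h1⟩ := by
    -- By `h1` and `h2` this is the decomposition of `α` along `M ⊕ D°`.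
    have e : α = β + (α - β) := (add_sub_cancel β α).symm
    rw [e, map_add, (Submodule.projectionOnto_apply_eq_zero_iff
      (isCompl_constraintSpace g D q)).2 h2, add_zero]
    exact Submodule.projectionOnto_apply_left (isCompl_constraintSpace g D q) ⟨β, h1⟩
  exact congrArg Subtype.val h3

lemma inCoordinates_metric {q₀ q : Q}
    (hq : q ∈ (trivializationAt (EuclideanSpace ℝ (Fin n)) (TangentSpace (𝓡 n)) q₀).baseSet)
    (v w : EuclideanSpace ℝ (Fin n)) :
    ContinuousLinearMap.inCoordinates (EuclideanSpace ℝ (Fin n)) (TangentSpace (𝓡 n))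
      (EuclideanSpace ℝ (Fin n) →L[ℝ] ℝ) (fun q : Q ↦ TangentSpace (𝓡 n) q →L[ℝ] ℝ)
      q₀ q q₀ q (g.inner q) v w =
    g.inner q
      ((trivializationAt (EuclideanSpace ℝ (Fin n)) (TangentSpace (𝓡 n)) q₀).symmL ℝ q v)
      ((trivializationAt (EuclideanSpace ℝ (Fin n)) (TangentSpace (𝓡 n)) q₀).symmL ℝ q w) := by
  rw [inCoordinates_apply_eq₂ hq hq (mem_univ _)]
  simp [Trivialization.symmL_apply _ hq]

/-- The orthogonal projection onto a smooth distribution is a smooth family of linear maps. -/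
theorem contMDiff_projD :
    ContMDiff (𝓡 n) ((𝓡 n).prod 𝓘(ℝ, EuclideanSpace ℝ (Fin n) →L[ℝ] EuclideanSpace ℝ (Fin k))) ∞
      (fun q ↦ TotalSpace.mk' (EuclideanSpace ℝ (Fin n) →L[ℝ] EuclideanSpace ℝ (Fin k))
        (E := fun q ↦ (TangentSpace (𝓡 n) q →L[ℝ] D.Fiber q)) q (projD g D q)) := by
  intro q₀
  rw [contMDiffAt_hom_bundle]
  refine ⟨contMDiffAt_id, ?_⟩
  set e := trivializationAt (EuclideanSpace ℝ (Fin n)) (TangentSpace (𝓡 n)) q₀ with he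
  set t := D.localTriv q₀ with ht
  have hU : t.U ∈ 𝓝 q₀ := t.isOpen_U.mem_nhds t.mem_U
  refine contMDiffAt_inverse_gram hU (t.contMDiffOn_A.contMDiffAt hU)
    ((contMDiffAt_hom_bundle _).1 (g.contMDiff q₀)).2 ?_ ?_
  · intro q hq c hc
    change ContinuousLinearMap.inCoordinates (EuclideanSpace ℝ (Fin n)) (TangentSpace (𝓡 n))
      (EuclideanSpace ℝ (Fin n) →L[ℝ] ℝ) (fun q : Q ↦ TangentSpace (𝓡 n) q →L[ℝ] ℝ)
      q₀ q q₀ q (g.inner q) _ _ ≠ 0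
    rw [inCoordinates_metric g (t.U_subset hq), ← t.incl_inv hq]
    -- The frame vector with coordinates `c` is nonzero, since `L` recovers `c` from it.
    refine (g.pos q _ fun h ↦ hc ?_).ne'
    rw [← t.L_inv hq c, h, map_zero, map_zero]
  · intro q hq v c
    change ContinuousLinearMap.inCoordinates (EuclideanSpace ℝ (Fin n)) (TangentSpace (𝓡 n))
      (EuclideanSpace ℝ (Fin n) →L[ℝ] ℝ) (fun q : Q ↦ TangentSpace (𝓡 n) q →L[ℝ] ℝ)
      q₀ q q₀ q (g.inner q) _ _ = ContinuousLinearMap.inCoordinates (EuclideanSpace ℝ (Fin n))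
      (TangentSpace (𝓡 n)) (EuclideanSpace ℝ (Fin n) →L[ℝ] ℝ)
      (fun q : Q ↦ TangentSpace (𝓡 n) q →L[ℝ] ℝ) q₀ q q₀ q (g.inner q) _ _
    rw [inCoordinates_metric g (t.U_subset hq), inCoordinates_metric g (t.U_subset hq),
      ← t.incl_inv hq, ← t.incl_inv hq]
    -- In coordinates `P` ends with the trivialization of `D`, which `t.inv` undoes. What is left is
    -- `inner_projD`.
    have h : ContinuousLinearMap.inCoordinates (EuclideanSpace ℝ (Fin n)) (TangentSpace (𝓡 n))
        (EuclideanSpace ℝ (Fin k)) D.Fiber q₀ q q₀ q (projD g D q) v =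
        t.L (e.continuousLinearMapAt ℝ q (D.incl q (projD g D q (e.symmL ℝ q v)))) :=
      D.trivializationAt_continuousLinearMapAt hq _
    refine Eq.trans ?_ (inner_projD g D q _ _)
    exact congrArg (fun u ↦ g.inner q (D.incl q u) (D.incl q (t.inv q c)))
      ((congrArg (t.inv q) h).trans (t.inv_L hq _))

/-- Covectors are linear maps into the trivial line bundle, so taking adjoints is fibrewise
composition: the tautological family `α ↦ α.snd` is composed with the pullback of the inclusion of
`D`. -/
theorem contMDiff_iDStar :
    ContMDiff (cotangentModel n) ((𝓡 n).prod 𝓘(ℝ, EuclideanSpace ℝ (Fin k) →L[ℝ] ℝ)) ∞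
      (iDStar D) := by
  intro α
  refine ContMDiffAt.clm_bundle_comp (b := TotalSpace.proj) (E₃ := fun _ : Q ↦ ℝ)
    (ψ := fun α : CotangentBundle n Q ↦ α.snd)
    (ϕ := fun α : CotangentBundle n Q ↦ D.incl α.proj) contMDiffAt_id ?_
  exact (D.contMDiff_incl α.proj).comp α (contMDiff_proj _ α)

theorem contMDiff_pStar :
    ContMDiff ((𝓡 n).prod 𝓘(ℝ, EuclideanSpace ℝ (Fin k) →L[ℝ] ℝ)) (cotangentModel n) ∞
      (pStar g D) := by
  intro μ
  refine ContMDiffAt.clm_bundle_comp (b := TotalSpace.proj) (E₃ := fun _ : Q ↦ ℝ)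
    (ψ := fun μ : DualBundle D ↦ μ.snd)
    (ϕ := fun μ : DualBundle D ↦ projD g D μ.proj) contMDiffAt_id ?_
  exact (contMDiff_projD g D μ.proj).comp μ (contMDiff_proj _ μ)

theorem contMDiff_iM : ContMDiff ((𝓡 n).prod (𝓡 k)) (cotangentModel n) ∞ (iM g D) :=
  (constraintBundle g D).contMDiff_inclTotal

/-- Smoothness into `M` can be tested after `i_M`, where `γ` becomes `P^* ∘ i_D^*`. -/
theorem contMDiff_gammaProj :
    ContMDiff (cotangentModel n) ((𝓡 n).prod (𝓡 k)) ∞ (gammaProj g D) := by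
  rw [(constraintBundle g D).contMDiff_iff_inclTotal]
  exact ((contMDiff_pStar g D).comp (contMDiff_iDStar D)).congr fun α ↦ iM_comp_gammaProj g D α

end Nonholonomic

/-! ### Cotangent lifts are symplectic -/

section CotangentLift

variable {E : Type*} [NormedAddCommGroup E] [NormedSpace ℝ E]

/-- The standard symplectic form `dq ∧ dp` on `E × E*`. -/
def standardForm (Z W : E × (E →L[ℝ] ℝ)) : ℝ := W.2 Z.1 - Z.2 W.1

/-- The cotangent lift of the coordinate change `φ`, written with its inverse `ψ`. -/
def cotangentLift (φ ψ : E → E) (z : E × (E →L[ℝ] ℝ)) : E × (E →L[ℝ] ℝ) :=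
  (φ z.1, z.2 ∘L fderiv ℝ ψ (φ z.1))

variable {φ ψ : E → E} {q : E}

/-- Product rule for `z.2 ∘ Dψ(φ z.1)`. The term with the second derivative of `ψ` is the one that
has to cancel in the symplectic form. -/
lemma hasFDerivAt_cotangentLift (hφ : DifferentiableAt ℝ φ q) (hψ : ContDiffAt ℝ 2 ψ (φ q))
    (p : E →L[ℝ] ℝ) :
    ∃ T : E × (E →L[ℝ] ℝ) →L[ℝ] E × (E →L[ℝ] ℝ), HasFDerivAt (cotangentLift φ ψ) T (q, p) ∧
      ∀ Z v, (T Z).1 = fderiv ℝ φ q Z.1 ∧ (T Z).2 v = Z.2 (fderiv ℝ ψ (φ q) v) +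
        p (fderiv ℝ (fderiv ℝ ψ) (φ q) (fderiv ℝ φ q Z.1) v) := by
  have hψ' : HasFDerivAt (fderiv ℝ ψ) (fderiv ℝ (fderiv ℝ ψ) (φ q)) (φ q) :=
    ((hψ.fderiv_right (m := 1) (by norm_num)).differentiableAt (by norm_num)).hasFDerivAt
  have h1 : HasFDerivAt (fun z : E × (E →L[ℝ] ℝ) ↦ φ z.1)
      (fderiv ℝ φ q ∘L ContinuousLinearMap.fst ℝ E (E →L[ℝ] ℝ)) (q, p) :=
    HasFDerivAt.comp (q, p) (f := Prod.fst) hφ.hasFDerivAt hasFDerivAt_fst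
  have h2 : HasFDerivAt (fun z : E × (E →L[ℝ] ℝ) ↦ fderiv ℝ ψ (φ z.1)) _ (q, p) :=
    HasFDerivAt.comp (q, p) (f := fun z : E × (E →L[ℝ] ℝ) ↦ φ z.1) hψ' h1
  have h3 : HasFDerivAt (fun z : E × (E →L[ℝ] ℝ) ↦ z.2)
      (ContinuousLinearMap.snd ℝ E (E →L[ℝ] ℝ)) (q, p) := hasFDerivAt_snd
  refine ⟨_, h1.prodMk (h3.clm_comp h2), fun Z v ↦ ⟨rfl, ?_⟩⟩
  simp [add_comm]

/-- Cotangent lifts of coordinate changes are symplectic. -/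
lemma standardForm_fderiv_cotangentLift (hφ : DifferentiableAt ℝ φ q)
    (hψ : ContDiffAt ℝ 2 ψ (φ q)) (hψφ : ∀ᶠ y in 𝓝 q, ψ (φ y) = y) (p : E →L[ℝ] ℝ)
    (Z W : E × (E →L[ℝ] ℝ)) :
    standardForm (fderiv ℝ (cotangentLift φ ψ) (q, p) Z) (fderiv ℝ (cotangentLift φ ψ) (q, p) W) =
      standardForm Z W := by
  obtain ⟨T, hT, hTapp⟩ := hasFDerivAt_cotangentLift hφ hψ p
  have hid : ∀ v, fderiv ℝ ψ (φ q) (fderiv ℝ φ q v) = v := fun v ↦ by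
    have h1 : HasFDerivAt (fun y ↦ ψ (φ y)) (fderiv ℝ ψ (φ q) ∘L fderiv ℝ φ q) q :=
      HasFDerivAt.comp q (hψ.differentiableAt (by norm_num)).hasFDerivAt hφ.hasFDerivAt
    have h2 : HasFDerivAt (fun y ↦ ψ (φ y)) (ContinuousLinearMap.id ℝ E) q :=
      (hasFDerivAt_id q).congr_of_eventuallyEq hψφ
    exact congrArg (fun f : E →L[ℝ] E ↦ f v) (h1.unique h2)
  have hsymm : IsSymmSndFDerivAt ℝ ψ (φ q) := hψ.isSymmSndFDerivAt (by simp)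
  -- The first-order terms reduce to `standardForm Z W` because `Dψ ∘ Dφ = id`; the two second-order
  -- terms cancel by symmetry of the second derivative.
  rw [hT.fderiv, standardForm, standardForm, (hTapp W _).2, (hTapp Z _).2, (hTapp Z 0).1,
    (hTapp W 0).1, hid, hid, hsymm.eq]
  ring

end CotangentLift

/-! ### The canonical form and bracket in a fixed chart -/

section Cotangent

variable {n : ℕ} {Q : Type*} [TopologicalSpace Q] [ChartedSpace (EuclideanSpace ℝ (Fin n)) Q]
  [IsManifold (𝓡 n) ∞ Q]

lemma isManifold_cotangentBundle_one : IsManifold (cotangentModel n) 1 (CotangentBundle n Q) :=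
  have : IsManifold (cotangentModel n) ∞ (CotangentBundle n Q) := inferInstance
  IsManifold.of_le (n := ∞) (by simp)

/-- A chart of `T*Q` covers all fibres over a chart domain of `Q`, so membership depends on the base
point only. -/
lemma mem_source_extChartAt_cotangentBundle {α₀ α : CotangentBundle n Q} :
    α ∈ (extChartAt (cotangentModel n) α₀).source ↔
      α.proj ∈ (chartAt (EuclideanSpace ℝ (Fin n)) α₀.proj).source := by
  have h : ∀ β : CotangentBundle n Q, (trivializationAt (EuclideanSpace ℝ (Fin n) →L[ℝ] ℝ)
      (fun q : Q ↦ TangentSpace (𝓡 n) q →L[ℝ] ℝ) α₀.proj β).1 = β.proj := fun _ ↦ rfl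
  rw [extChartAt_source]
  simp [FiberBundle.chartedSpace_chartAt, h]

lemma mdifferentiableAt_canonicalCoords {α₀ α : CotangentBundle n Q}
    (hα : α ∈ (extChartAt (cotangentModel n) α₀).source) :
    MDifferentiableAt (cotangentModel n)
      𝓘(ℝ, EuclideanSpace ℝ (Fin n) × (EuclideanSpace ℝ (Fin n) →L[ℝ] ℝ))
      (canonicalCoords α₀) α := by
  have := isManifold_cotangentBundle_one (n := n) (Q := Q)
  rw [canonicalCoords_eq_extChartAt]
  exact mdifferentiableAt_extChartAt (by rwa [extChartAt_source] at hα)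

lemma mvfderiv_canonicalCoords_surjective {α₀ α : CotangentBundle n Q}
    (hα : α ∈ (extChartAt (cotangentModel n) α₀).source) :
    Function.Surjective (mvfderiv (cotangentModel n) (canonicalCoords α₀) α) := by
  have := isManifold_cotangentBundle_one (n := n) (Q := Q)
  obtain ⟨e, he⟩ := isInvertible_mfderiv_extChartAt (I := cotangentModel n) hα
  have h : ⇑(mvfderiv (cotangentModel n) (canonicalCoords α₀) α) = ⇑e := by
    funext Z
    rw [canonicalCoords_eq_extChartAt]
    exact congrArg (fun f ↦ f Z) he.symm
  rw [h]
  exact e.surjective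

/-- Canonical coordinates at two points are related by a cotangent lift. -/
lemma canonicalCoords_eq_cotangentLift {α₀ α β : CotangentBundle n Q}
    (hβ₀ : β.proj ∈ (chartAt (EuclideanSpace ℝ (Fin n)) α₀.proj).source)
    (hβ : β.proj ∈ (chartAt (EuclideanSpace ℝ (Fin n)) α.proj).source) :
    canonicalCoords α β =
      cotangentLift (extChartAt (𝓡 n) α.proj ∘ (extChartAt (𝓡 n) α₀.proj).symm)
        (extChartAt (𝓡 n) α₀.proj ∘ (extChartAt (𝓡 n) α.proj).symm) (canonicalCoords α₀ β) := by
  have : IsManifold (𝓡 n) 1 Q := IsManifold.of_le (n := ∞) (by simp)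
  have h1 : (extChartAt (𝓡 n) α₀.proj).symm (extChartAt (𝓡 n) α₀.proj β.proj) = β.proj :=
    (extChartAt (𝓡 n) α₀.proj).left_inv (by rwa [extChartAt_source])
  refine Prod.ext ?_ ?_
  · simp only [canonicalCoords, cotangentLift, Function.comp_apply, h1]
  · simp only [canonicalCoords, cotangentLift, Function.comp_apply, h1]
    -- The derivative of the inverse coordinate change is the tangent coordinate change from `α` to
    -- `α₀`. The momenta then agree by the cocycle identity `h3`.
    have h2 : fderiv ℝ (extChartAt (𝓡 n) α₀.proj ∘ (extChartAt (𝓡 n) α.proj).symm)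
        (extChartAt (𝓡 n) α.proj β.proj) =
        tangentCoordChange (𝓡 n) α.proj α₀.proj β.proj := by
      rw [tangentCoordChange_def, ModelWithCorners.range_eq_univ, fderivWithin_univ]
    rw [h2]
    ext1 v
    simp only [ContinuousLinearMap.comp_apply]
    rw [TangentBundle.symmL_trivializationAt_eq_core hβ,
      TangentBundle.symmL_trivializationAt_eq_core hβ₀]
    have h3 : tangentCoordChange (𝓡 n) α₀.proj β.proj β.proj
        (tangentCoordChange (𝓡 n) α.proj α₀.proj β.proj v) =
        tangentCoordChange (𝓡 n) α.proj β.proj β.proj v := by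
      apply tangentCoordChange_comp
      simp only [extChartAt_source]
      exact ⟨⟨hβ, hβ₀⟩, mem_chart_source _ _⟩
    exact congrArg β.snd h3.symm

lemma contDiffAt_extCoordChange {x y z : Q}
    (hx : z ∈ (chartAt (EuclideanSpace ℝ (Fin n)) x).source)
    (hy : z ∈ (chartAt (EuclideanSpace ℝ (Fin n)) y).source) :
    ContDiffAt ℝ 2 (extChartAt (𝓡 n) y ∘ (extChartAt (𝓡 n) x).symm) (extChartAt (𝓡 n) x z) := by
  have : IsManifold (𝓡 n) 2 Q := inferInstance
  have hx' : z ∈ (extChartAt (𝓡 n) x).source := by rwa [extChartAt_source]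
  have h := contDiffWithinAt_ext_coord_change (I := 𝓡 n) (n := 2) y x (y := extChartAt (𝓡 n) x z) (by
    rw [PartialEquiv.trans_source, PartialEquiv.symm_source]
    refine ⟨(extChartAt (𝓡 n) x).map_source hx', ?_⟩
    rw [mem_preimage, (extChartAt (𝓡 n) x).left_inv hx', extChartAt_source]
    exact hy)
  rwa [ModelWithCorners.range_eq_univ, contDiffWithinAt_univ] at h

/-- The canonical symplectic form has the standard expression in all canonical coordinates. -/
lemma canonicalForm_eq_standardForm {α₀ α : CotangentBundle n Q}
    (hα : α ∈ (extChartAt (cotangentModel n) α₀).source)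
    (Z W : TangentSpace (cotangentModel n) α) :
    canonicalForm α Z W =
      standardForm (mvfderiv (cotangentModel n) (canonicalCoords α₀) α Z)
        (mvfderiv (cotangentModel n) (canonicalCoords α₀) α W) := by
  have hα' := mem_source_extChartAt_cotangentBundle.1 hα
  set φ := extChartAt (𝓡 n) α.proj ∘ (extChartAt (𝓡 n) α₀.proj).symm with hφdef
  set ψ := extChartAt (𝓡 n) α₀.proj ∘ (extChartAt (𝓡 n) α.proj).symm with hψdef
  have h1 : (extChartAt (𝓡 n) α₀.proj).symm (extChartAt (𝓡 n) α₀.proj α.proj) = α.proj :=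
    (extChartAt (𝓡 n) α₀.proj).left_inv (by rwa [extChartAt_source])
  have hφq : φ (extChartAt (𝓡 n) α₀.proj α.proj) = extChartAt (𝓡 n) α.proj α.proj := by
    rw [hφdef, Function.comp_apply, h1]
  have hφ : ContDiffAt ℝ 2 φ (extChartAt (𝓡 n) α₀.proj α.proj) :=
    contDiffAt_extCoordChange hα' (mem_chart_source _ _)
  have hψ : ContDiffAt ℝ 2 ψ (φ (extChartAt (𝓡 n) α₀.proj α.proj)) := by
    rw [hφq]
    exact contDiffAt_extCoordChange (mem_chart_source _ _) hα'
  have hψφ : ∀ᶠ y in 𝓝 (extChartAt (𝓡 n) α₀.proj α.proj), ψ (φ y) = y := by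
    have ht : (extChartAt (𝓡 n) α₀.proj).target ∈ 𝓝 (extChartAt (𝓡 n) α₀.proj α.proj) :=
      extChartAt_target_mem_nhds'
        ((extChartAt (𝓡 n) α₀.proj).map_source (by rwa [extChartAt_source]))
    have hc : (extChartAt (𝓡 n) α₀.proj).symm ⁻¹' (extChartAt (𝓡 n) α.proj).source ∈
        𝓝 (extChartAt (𝓡 n) α₀.proj α.proj) := by
      refine (continuousAt_extChartAt_symm' (I := 𝓡 n) (by rwa [extChartAt_source])).preimage_mem_nhds ?_
      rw [h1]
      exact extChartAt_source_mem_nhds _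
    filter_upwards [ht, hc] with y hy hy'
    simp only [hφdef, hψdef, Function.comp_apply]
    rw [(extChartAt (𝓡 n) α.proj).left_inv hy', (extChartAt (𝓡 n) α₀.proj).right_inv hy]
  -- Both coordinate systems are defined near `α`, so the relation holds on a neighbourhood and can
  -- be differentiated at `α`.
  have hev : canonicalCoords α =ᶠ[𝓝 α] cotangentLift φ ψ ∘ canonicalCoords α₀ := by
    have hs := extChartAt_source_mem_nhds (I := cotangentModel n) α
    have hs₀ := extChartAt_source_mem_nhds' (I := cotangentModel n) hα
    filter_upwards [hs, hs₀] with β hβ hβ₀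
    exact canonicalCoords_eq_cotangentLift (mem_source_extChartAt_cotangentBundle.1 hβ₀)
      (mem_source_extChartAt_cotangentBundle.1 hβ)
  have hT : DifferentiableAt ℝ (cotangentLift φ ψ) (canonicalCoords α₀ α) := by
    obtain ⟨T, hT, -⟩ := hasFDerivAt_cotangentLift (hφ.differentiableAt (by simp))
      hψ (canonicalCoords α₀ α).2
    exact hT.differentiableAt
  have hd : ∀ Z, dCanonicalCoords α Z = fderiv ℝ (cotangentLift φ ψ) (canonicalCoords α₀ α)
      (mvfderiv (cotangentModel n) (canonicalCoords α₀) α Z) := by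
    intro Z
    have h2 : mfderiv (cotangentModel n)
        𝓘(ℝ, EuclideanSpace ℝ (Fin n) × (EuclideanSpace ℝ (Fin n) →L[ℝ] ℝ))
        (canonicalCoords α) α = _ := hev.mfderiv_eq
    have h3 := mfderiv_comp α hT.mdifferentiableAt (mdifferentiableAt_canonicalCoords hα)
    rw [mfderiv_eq_fderiv] at h3
    exact congrArg (fun f ↦ f Z) (h2.trans h3)
  change standardForm (dCanonicalCoords α Z) (dCanonicalCoords α W) = _
  rw [hd, hd]
  exact standardForm_fderiv_cotangentLift (hφ.differentiableAt (by simp))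
    hψ hψφ _ _ _

lemma contDiffOn_comp_extChartAt_symm (α₀ : CotangentBundle n Q) {F : CotangentBundle n Q → ℝ}
    (hF : ContMDiff (cotangentModel n) 𝓘(ℝ) ∞ F) :
    ContDiffOn ℝ ∞ (F ∘ (extChartAt (cotangentModel n) α₀).symm)
      (extChartAt (cotangentModel n) α₀).target :=
  (hF.comp_contMDiffOn (contMDiffOn_extChartAt_symm α₀)).contDiffOn

/-- Chain rule for `F = (F ∘ κ⁻¹) ∘ κ`, with `κ` the canonical coordinates at `α₀`. -/
lemma mvfderiv_eq_fderiv_canonicalCoords {α₀ α : CotangentBundle n Q}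
    (hα : α ∈ (extChartAt (cotangentModel n) α₀).source) {F : CotangentBundle n Q → ℝ}
    (hF : ContMDiff (cotangentModel n) 𝓘(ℝ) ∞ F) (Z : TangentSpace (cotangentModel n) α) :
    mvfderiv (cotangentModel n) F α Z =
      fderiv ℝ (F ∘ (extChartAt (cotangentModel n) α₀).symm) (canonicalCoords α₀ α)
        (mvfderiv (cotangentModel n) (canonicalCoords α₀) α Z) := by
  have hmem : canonicalCoords α₀ α ∈ (extChartAt (cotangentModel n) α₀).target := by
    rw [canonicalCoords_eq_extChartAt]
    exact (extChartAt (cotangentModel n) α₀).map_source hα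
  have hd : DifferentiableAt ℝ (F ∘ (extChartAt (cotangentModel n) α₀).symm)
      (canonicalCoords α₀ α) :=
    ((contDiffOn_comp_extChartAt_symm α₀ hF).contDiffAt
      (extChartAt_target_mem_nhds' hmem)).differentiableAt (by simp)
  have hev : F =ᶠ[𝓝 α] (F ∘ (extChartAt (cotangentModel n) α₀).symm) ∘ canonicalCoords α₀ := by
    filter_upwards [extChartAt_source_mem_nhds' (I := cotangentModel n) hα] with β hβ
    rw [canonicalCoords_eq_extChartAt]
    exact congrArg F ((extChartAt (cotangentModel n) α₀).left_inv hβ).symm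
  have h2 : mfderiv (cotangentModel n) 𝓘(ℝ) F α = _ := hev.mfderiv_eq
  have h3 := mfderiv_comp α hd.mdifferentiableAt (mdifferentiableAt_canonicalCoords hα)
  rw [mfderiv_eq_fderiv] at h3
  exact congrArg (fun f ↦ f Z) (h2.trans h3)

/-- The standard Poisson bracket of two covectors on `ℝⁿ × (ℝⁿ)*`. -/
def standardBracket (a b : EuclideanSpace ℝ (Fin n) × (EuclideanSpace ℝ (Fin n) →L[ℝ] ℝ) →L[ℝ] ℝ) :
    ℝ :=
  ∑ i, (a (EuclideanSpace.single i 1, 0) * b (0, EuclideanSpace.proj i) -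
    a (0, EuclideanSpace.proj i) * b (EuclideanSpace.single i 1, 0))

/-- Testing `hX` on `(0, proj i)` and `(eᵢ, 0)` gives the components `X.1 i` and `-X.2 eᵢ` as values
of `a`; likewise for `Y` and `b`. This eliminates the Hamiltonian vectors from the bracket. -/
lemma standardForm_eq_standardBracket
    {a b : EuclideanSpace ℝ (Fin n) × (EuclideanSpace ℝ (Fin n) →L[ℝ] ℝ) →L[ℝ] ℝ}
    {X Y : EuclideanSpace ℝ (Fin n) × (EuclideanSpace ℝ (Fin n) →L[ℝ] ℝ)}
    (hX : ∀ Z, standardForm X Z = a Z) (hY : ∀ Z, standardForm Y Z = b Z) :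
    standardForm X Y = standardBracket a b := by
  have hrep : ∀ (p : EuclideanSpace ℝ (Fin n) →L[ℝ] ℝ) (v : EuclideanSpace ℝ (Fin n)),
      p v = ∑ i, v i * p (EuclideanSpace.single i 1) := fun p v ↦ by
    conv_lhs => rw [← (EuclideanSpace.basisFun (Fin n) ℝ).sum_repr v]
    simp
  rw [standardForm, hrep, hrep X.2, ← Finset.sum_sub_distrib, standardBracket]
  refine Finset.sum_congr rfl fun i _ ↦ ?_
  rw [← hX, ← hX, ← hY, ← hY]
  simp [standardForm]
  ring

/-- The canonical Poisson bracket in canonical coordinates. -/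
lemma canonicalBracket_eq_standardBracket {α₀ α : CotangentBundle n Q}
    (hα : α ∈ (extChartAt (cotangentModel n) α₀).source) {F G : CotangentBundle n Q → ℝ}
    (hF : ContMDiff (cotangentModel n) 𝓘(ℝ) ∞ F) (hG : ContMDiff (cotangentModel n) 𝓘(ℝ) ∞ G) :
    canonicalBracket F G α = standardBracket
      (fderiv ℝ (F ∘ (extChartAt (cotangentModel n) α₀).symm) (canonicalCoords α₀ α))
      (fderiv ℝ (G ∘ (extChartAt (cotangentModel n) α₀).symm) (canonicalCoords α₀ α)) := by
  have key : ∀ {F : CotangentBundle n Q → ℝ}, ContMDiff (cotangentModel n) 𝓘(ℝ) ∞ F → ∀ Z,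
      standardForm (mvfderiv (cotangentModel n) (canonicalCoords α₀) α
        (hamiltonianVectorField F α)) Z =
      fderiv ℝ (F ∘ (extChartAt (cotangentModel n) α₀).symm) (canonicalCoords α₀ α) Z := by
    intro F hF Z
    -- Every model vector is the image of a tangent vector, on which the defining equation of the
    -- Hamiltonian vector field can be used.
    obtain ⟨Z, rfl⟩ := mvfderiv_canonicalCoords_surjective hα Z
    rw [← canonicalForm_eq_standardForm hα, canonicalForm_hamiltonianVectorField,
      mvfderiv_eq_fderiv_canonicalCoords hα hF]
  rw [canonicalBracket, canonicalForm_eq_standardForm hα]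
  exact standardForm_eq_standardBracket (key hF) (key hG)

theorem contMDiff_canonicalBracket {F G : CotangentBundle n Q → ℝ}
    (hF : ContMDiff (cotangentModel n) 𝓘(ℝ) ∞ F) (hG : ContMDiff (cotangentModel n) 𝓘(ℝ) ∞ G) :
    ContMDiff (cotangentModel n) 𝓘(ℝ) ∞ (canonicalBracket F G) := by
  intro α₀
  have : IsManifold (cotangentModel n) ∞ (CotangentBundle n Q) := inferInstance
  have hs := extChartAt_source_mem_nhds (I := cotangentModel n) α₀
  have hκ : ContMDiffAt (cotangentModel n)
      𝓘(ℝ, EuclideanSpace ℝ (Fin n) × (EuclideanSpace ℝ (Fin n) →L[ℝ] ℝ)) ∞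
      (canonicalCoords α₀) α₀ := by
    rw [canonicalCoords_eq_extChartAt]
    exact contMDiffAt_extChartAt
  have hd : ∀ {F : CotangentBundle n Q → ℝ}, ContMDiff (cotangentModel n) 𝓘(ℝ) ∞ F →
      ∀ Z, ContMDiffAt (cotangentModel n) 𝓘(ℝ) ∞ (fun α ↦
        fderiv ℝ (F ∘ (extChartAt (cotangentModel n) α₀).symm) (canonicalCoords α₀ α) Z) α₀ := by
    intro F hF Z
    have h1 : ContDiffAt ℝ ∞ (F ∘ (extChartAt (cotangentModel n) α₀).symm)
        (canonicalCoords α₀ α₀) := by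
      refine (contDiffOn_comp_extChartAt_symm α₀ hF).contDiffAt ?_
      rw [canonicalCoords_eq_extChartAt]
      exact extChartAt_target_mem_nhds α₀
    have h2 : ContDiffAt ℝ ∞ (fun z ↦
        fderiv ℝ (F ∘ (extChartAt (cotangentModel n) α₀).symm) z Z) (canonicalCoords α₀ α₀) :=
      (h1.fderiv_right (m := ∞) (by simp)).clm_apply contDiffAt_const
    exact h2.contMDiffAt.comp α₀ hκ
  -- With `α₀` fixed, the coordinate formula holds on the whole chart domain, not only at its
  -- centre.
  refine ContMDiffAt.congr_of_eventuallyEq ?_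
    (Filter.mem_of_superset hs fun α hα ↦ canonicalBracket_eq_standardBracket hα hF hG)
  unfold standardBracket
  refine contMDiffAt_finsetSum fun i _ ↦ ?_
  exact ((hd hF _).mul (hd hG _)).sub ((hd hF _).mul (hd hG _))

lemma canonicalBracket_apply (F G : CotangentBundle n Q → ℝ) (α : CotangentBundle n Q) :
    canonicalBracket F G α =
      mvfderiv (cotangentModel n) F α (hamiltonianVectorField G α) :=
  canonicalForm_hamiltonianVectorField F α _

lemma canonicalBracket_skew (F G : CotangentBundle n Q → ℝ) :
    canonicalBracket G F = -canonicalBracket F G := by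
  funext α
  simp only [canonicalBracket, canonicalForm, Pi.neg_apply, neg_sub]

/-- The canonical Poisson bracket satisfies the algebraic rules of an almost Poisson bracket. -/
theorem isAlmostPoissonBracket_canonicalBracket :
    IsAlmostPoissonBracket (cotangentModel n)
      (canonicalBracket : (CotangentBundle n Q → ℝ) → (CotangentBundle n Q → ℝ) → _) := by
  have hadd : ∀ f f' g : CotangentBundle n Q → ℝ, ContMDiff (cotangentModel n) 𝓘(ℝ) ∞ f →
      ContMDiff (cotangentModel n) 𝓘(ℝ) ∞ f' →
      canonicalBracket (f + f') g = canonicalBracket f g + canonicalBracket f' g := by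
    intro f f' g hf hf'
    funext α
    simp only [Pi.add_apply, canonicalBracket_apply]
    rw [mvfderiv_add ((hf α).mdifferentiableAt (by simp)) ((hf' α).mdifferentiableAt (by simp))]
    rfl
  have hsmul : ∀ (c : ℝ) (f g : CotangentBundle n Q → ℝ), ContMDiff (cotangentModel n) 𝓘(ℝ) ∞ f →
      canonicalBracket (c • f) g = c • canonicalBracket f g := by
    intro c f g hf
    funext α
    simp only [Pi.smul_apply, canonicalBracket_apply]
    -- A scalar is a constant function, so the product rule applies with one vanishing term.
    have h : c • f = (fun _ ↦ c) * f := rfl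
    rw [h, mvfderiv_mul mdifferentiableAt_const ((hf α).mdifferentiableAt (by simp)),
      mvfderiv_const, smul_zero, add_zero]
    rfl
  refine ⟨fun f g ↦ contMDiff_canonicalBracket, fun f f' g hf hf' _ ↦ hadd f f' g hf hf',
    fun c f g hf _ ↦ hsmul c f g hf, fun f g g' _ hg hg' ↦ ?_, fun c f g _ hg ↦ ?_,
    fun f g _ _ ↦ canonicalBracket_skew f g, fun f f' g hf hf' _ ↦ ?_⟩
  · rw [canonicalBracket_skew, hadd _ _ _ hg hg', neg_add, ← canonicalBracket_skew,
      ← canonicalBracket_skew]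
  · rw [canonicalBracket_skew, hsmul _ _ _ hg, ← smul_neg, ← canonicalBracket_skew]
  · funext α
    simp only [Pi.add_apply, Pi.mul_apply, canonicalBracket_apply]
    rw [mvfderiv_mul ((hf α).mdifferentiableAt (by simp)) ((hf' α).mdifferentiableAt (by simp))]
    rfl

end Cotangent

/-! ### Transport of brackets along a retraction -/

section AlmostPoisson

variable {E : Type*} [NormedAddCommGroup E] [NormedSpace ℝ E] {H : Type*} [TopologicalSpace H]
  {X : Type*} [TopologicalSpace X] [ChartedSpace H X]
  {E' : Type*} [NormedAddCommGroup E'] [NormedSpace ℝ E'] {H' : Type*} [TopologicalSpace H']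
  {Y : Type*} [TopologicalSpace Y] [ChartedSpace H' Y]

/-- Conjugating an almost Poisson bracket on `X` by smooth maps `r : X → Y` and `s : Y → X` with
`r ∘ s = id` gives an almost Poisson bracket on `Y`. -/
lemma IsAlmostPoissonBracket.of_retraction {I : ModelWithCorners ℝ E H}
    {J : ModelWithCorners ℝ E' H'} {br : (X → ℝ) → (X → ℝ) → X → ℝ}
    (hbr : IsAlmostPoissonBracket I br) {r : X → Y} {s : Y → X} (hr : ContMDiff I J ∞ r)
    (hs : ContMDiff J I ∞ s) (hrs : ∀ y, r (s y) = y) :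
    IsAlmostPoissonBracket J (fun f h ↦ br (f ∘ r) (h ∘ r) ∘ s) where
  contMDiff f g hf hg := (hbr.contMDiff _ _ (hf.comp hr) (hg.comp hr)).comp hs
  add_left f f' g hf hf' hg := congrArg (· ∘ s)
    (hbr.add_left _ _ _ (hf.comp hr) (hf'.comp hr) (hg.comp hr))
  smul_left c f g hf hg := congrArg (· ∘ s) (hbr.smul_left c _ _ (hf.comp hr) (hg.comp hr))
  add_right f g g' hf hg hg' := congrArg (· ∘ s)
    (hbr.add_right _ _ _ (hf.comp hr) (hg.comp hr) (hg'.comp hr))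
  smul_right c f g hf hg := congrArg (· ∘ s) (hbr.smul_right c _ _ (hf.comp hr) (hg.comp hr))
  skew f g hf hg := congrArg (· ∘ s) (hbr.skew _ _ (hf.comp hr) (hg.comp hr))
  leibniz f f' g hf hf' hg := by
    funext y
    -- The prefactors come out as `f (r (s y))`; the Leibniz rule is the only one that needs `r ∘ s
    -- = id`.
    have h := congrFun (hbr.leibniz _ _ _ (hf.comp hr) (hf'.comp hr) (hg.comp hr)) (s y)
    simp only [Pi.add_apply, Pi.mul_apply, Function.comp_apply, hrs] at h
    exact h

end AlmostPoisson

/-! ### The isomorphism `M ≅ D*` -/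

section Nonholonomic

variable {n k : ℕ} {Q : Type*} [TopologicalSpace Q] [ChartedSpace (EuclideanSpace ℝ (Fin n)) Q]
  [IsManifold (𝓡 n) ∞ Q] (g : RiemannianMetricOn n Q) (D : SmoothDistribution k n Q)

/-- The diffeomorphism `i_D^* ∘ i_M : M → D*`, with inverse `γ ∘ P^*`. -/
def constraintDiffeomorph : Diffeomorph ((𝓡 n).prod (𝓡 k))
    ((𝓡 n).prod 𝓘(ℝ, EuclideanSpace ℝ (Fin k) →L[ℝ] ℝ)) (ConstraintManifold g D)
    (DualBundle D) ∞ where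
  toFun := iDStar D ∘ iM g D
  invFun := gammaProj g D ∘ pStar g D
  left_inv α := by
    simp only [Function.comp_apply]
    rw [← iM_comp_gammaProj, gammaProj_comp_iM, gammaProj_comp_iM]
  right_inv μ := by
    simp only [Function.comp_apply]
    rw [iM_comp_gammaProj, iDStar_comp_pStar, iDStar_comp_pStar]
  contMDiff_toFun := (contMDiff_iDStar D).comp (contMDiff_iM g D)
  contMDiff_invFun := (contMDiff_gammaProj g D).comp (contMDiff_pStar g D)

end Nonholonomic

end

theorem theorem1 {n k : ℕ} {Q : Type*} [TopologicalSpace Q]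
    [ChartedSpace (EuclideanSpace ℝ (Fin n)) Q] [IsManifold (𝓡 n) ∞ Q]
    (g : RiemannianMetricOn n Q) (D : SmoothDistribution k n Q) :
    IsVectorBundleIso (𝓡 n) (iDStar D ∘ iM g D) ∧
    IsAlmostPoissonIso ((𝓡 n).prod (𝓡 k))
      ((𝓡 n).prod 𝓘(ℝ, EuclideanSpace ℝ (Fin k) →L[ℝ] ℝ))
      (edenBracket g D) (dualBracket g D) (iDStar D ∘ iM g D) := by
  have hbr := isAlmostPoissonBracket_canonicalBracket (n := n) (Q := Q)
  have hΦγ : ∀ α, iDStar D (iM g D (gammaProj g D α)) = iDStar D α := fun α ↦ by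
    rw [iM_comp_gammaProj, iDStar_comp_pStar]
  have hΦ : ∀ f : DualBundle D → ℝ, (f ∘ iDStar D ∘ iM g D) ∘ gammaProj g D = f ∘ iDStar D :=
    fun f ↦ funext fun α ↦ congrArg f (hΦγ α)
  refine ⟨⟨⟨constraintDiffeomorph g D, rfl⟩, ?_⟩, ?_, ?_, ⟨constraintDiffeomorph g D, rfl⟩, ?_⟩
  · let φ (q : Q) : (constraintBundle g D).Fiber q →ₗ[ℝ] (D.Fiber q →L[ℝ] ℝ) :=
      { toFun := fun α ↦ (constraintBundle g D).incl q α ∘L D.incl q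
        map_add' := fun _ _ ↦ rfl
        map_smul' := fun _ _ ↦ rfl }
    -- Fibrewise bijectivity is inherited from the diffeomorphism, since both it and its inverse `γ
    -- ∘ P^*` cover the identity of `Q`.
    have hφ : ∀ q, Function.Bijective (φ q) := by
      intro q
      constructor
      · intro α β h
        have h' := (constraintDiffeomorph g D).injective
          (a₁ := (⟨q, α⟩ : ConstraintManifold g D)) (a₂ := (⟨q, β⟩ : ConstraintManifold g D))
          (congrArg (TotalSpace.mk q) h)
        exact TotalSpace.mk_injective q h'
      · intro μ
        refine ⟨(gammaProj g D (pStar g D ⟨q, μ⟩)).snd, ?_⟩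
        exact TotalSpace.mk_injective q ((constraintDiffeomorph g D).right_inv ⟨q, μ⟩)
    exact ⟨fun q ↦ LinearEquiv.ofBijective (φ q) (hφ q), fun q α ↦ rfl⟩
  · exact hbr.of_retraction (contMDiff_gammaProj g D) (contMDiff_iM g D) (gammaProj_comp_iM g D)
  · exact hbr.of_retraction (contMDiff_iDStar D) (contMDiff_pStar g D) (iDStar_comp_pStar g D)
  · intro f h _ _
    funext α
    simp only [edenBracket, dualBracket, Function.comp_apply]
    -- This is `P^* ∘ Φ = i_M`: both brackets are evaluated at the same covector, and `hΦ`
    -- identifies their arguments.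
    rw [← iM_comp_gammaProj, gammaProj_comp_iM]
    exact congrFun (congrArg₂ canonicalBracket (hΦ f) (hΦ h)) _
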